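/- Let $\mathcal X$ be a real Hilbert space and let $g:\mathcal X\to\mathbb R$ be convex and differentiable with $\operatorname{argmin} g\neq\emptyset$. Let $\alpha,a,\beta,h>0$, $0<q<1$ and $1<p<q+1$. Let $(\delta_k)_{k\ge1}$ be a non-decreasing sequence of positive reals with $\delta_k\to+\infty$ such that - (growth condition $(\mathcal G)$) there is $c>0$ such that $\delta_{k+1}\le \dfrac{k^p}{(1+c)k^p-c(k+1)^p}\,\delta_k$ for all sufficiently large $k$; - there is $c_0>0$ such that $\delta_k^2\ge c_0k^{p-q}$ for all $k\ge1$. For $k\ge 1$ put $a_k=a(kh)^{-p}$, $d_k=\dfrac{(kh)^{q+p}}{(kh)^{q+p}+\alpha h(kh)^p+ah^2(kh)^q}$ and $\rho_k=d_k(\beta h+h^2\delta_k)$. A sequence $(x_k)_{k\ge0}$ in $\mathcal X$ is generated by (IPGA) if $x_0,x_1$ are arbitrary and, for all $k\ge1$, $$y_k=x_k+d_k\bigl(x_k-x_{k-1}+\beta h\nabla g(x_k)\bigr),\qquad x_{k+1}=\operatorname{prox}_{\rho_kg}\bigl(y_k-h^2d_ka_kx_k\bigr),$$ where $\operatorname{prox}_{\rho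 g}(z)$ is the minimizer of $w\mapsto g(w)+\frac1{2\rho}\|w-z\|^2$. Then $\operatorname{argmin}g$ has a unique element $\bar x^*$ of minimum norm, for each $k\ge1$ the function $x\mapsto g(x)+\frac{a_k}{2\delta_k}\|x\|^2$ has a unique minimizer $\bar x_k$, and every sequence $(x_k)$ generated by (IPGA) satisfies $\lim_{k\to\infty}\|x_k-\bar x^*\|=0$ and, as $k\to+\infty$: (i) If $1<p<2q$, then $$g(x_k)-g(\bar x^*)=\mathcal O\Bigl(\tfrac1{k^p\delta_k}\Bigr),\quad \|x_k-\bar x_k\|=\mathcal O\Bigl(\tfrac1{k^{(1-q)/2}}\Bigr),\quad \|\nabla g(x_k)\|=\mathcal O\Bigl(\tfrac1{k^{(p-q+1)/2}\delta_k}\Bigr),\quad \|x_k-x_{k-1}\|=\mathcal O\Bigl(\tfrac1{k^{(p-q+1)/2}}\Bigr).$$ (ii) If $2q\le p<\frac12(3q+1)$, then $$g(x_k)-g(\bar x^*)=\mathcal O\Bigl(\tfrac1{k^p\delta_k}\Bigr),\quad \|x_k-\bar x_k\|=\mathcal O\Bigl(\tfrac1{k^{(1-q)/2}}\Bigr),\quad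 \|\nabla g(x_k)\|=\mathcal O\Bigl(\tfrac1{k^{(q+1)/2}\delta_k}\Bigr),\quad \|x_k-x_{k-1}\|=\mathcal O\Bigl(\tfrac1{k^{(q+1)/2}}\Bigr).$$ (iii) If $\frac12(3q+1)\le p<q+1$, then $$\|x_k-\bar x_k\|=\mathcal O\Bigl(\tfrac1{k^{q-p+1}}\Bigr),\quad \|\nabla g(x_k)\|=\mathcal O\Bigl(\tfrac1{k^{2q-p+1}\delta_k}\Bigr),\quad \|x_k-x_{k-1}\|=\mathcal O\Bigl(\tfrac1{k^{2q-p+1}}\Bigr).$$ Further, $g(x_k)-g(\bar x^*)=\mathcal O\bigl(\tfrac1{k^p\delta_k}\bigr)$ if $\frac12(3q+1)\le p<\frac13(4q+2)$, and $g(x_k)-g(\bar x^*)=\mathcal O\bigl(\tfrac1{k^{4q-2p+2}\delta_k}\bigr)$ if $\frac13(4q+2)\le p<q+1$. -/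

import Mathlib

open Filter Topology Asymptotics

noncomputable section

/-- The solution set `argmin g` of `min_{x ∈ X} g x`. -/
def argminSet {X : Type*} (g : X → ℝ) : Set X :=
  {x | IsMinOn g Set.univ x}

/-- `z` is the minimum-norm element of `argmin g`. -/
def IsMinNormSolution {X : Type*} [NormedAddCommGroup X] (g : X → ℝ) (z : X) : Prop :=
  z ∈ argminSet g ∧ ∀ y ∈ argminSet g, ‖z‖ ≤ ‖y‖

/-- `z` is a minimizer of the Tikhonov regularized function `x ↦ g x + (ε / 2) ‖x‖²`. -/
def IsTikhonovPoint {X : Type*} [NormedAddCommGroup X] (g : X → ℝ) (ε : ℝ) (z : X) : Prop :=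
  IsMinOn (fun x => g x + ε / 2 * ‖x‖ ^ 2) Set.univ z

/-- `u = prox_{ρ g} (z)`, that is, `u` minimizes `w ↦ g w + ‖w - z‖² / (2 ρ)`. -/
def IsProx {X : Type*} [NormedAddCommGroup X] (ρ : ℝ) (g : X → ℝ) (z u : X) : Prop :=
  IsMinOn (fun w => g w + 1 / (2 * ρ) * ‖w - z‖ ^ 2) Set.univ u

/-- The Tikhonov regularization parameter `a_k = a (k h)^(-p)`. -/
def tikhonovParam (a h p : ℝ) (k : ℕ) : ℝ :=
  a * ((k : ℝ) * h) ^ (-p)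

/-- The inertial parameter
`d_k = (k h)^(q+p) / ((k h)^(q+p) + α h (k h)^p + a h² (k h)^q)`. -/
def inertialParam (α a h q p : ℝ) (k : ℕ) : ℝ :=
  ((k : ℝ) * h) ^ (q + p) /
    (((k : ℝ) * h) ^ (q + p) + α * h * ((k : ℝ) * h) ^ p + a * h ^ 2 * ((k : ℝ) * h) ^ q)

/-- The step size `ρ_k = d_k (β h + h² δ_k)`. -/
def stepSize (α a β h q p : ℝ) (δ : ℕ → ℝ) (k : ℕ) : ℝ :=
  inertialParam α a h q p k * (β * h + h ^ 2 * δ k)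

/-- The sequence `x` (with arbitrary `x 0`, `x 1`) is generated by the inertial proximal gradient
algorithm: for all `k ≥ 1`, with `y_k = x_k + d_k (x_k - x_{k-1} + β h ∇g(x_k))`,
`x_{k+1} = prox_{ρ_k g} (y_k - h² d_k a_k x_k)`. -/
def IsIPGASequence {X : Type*} [NormedAddCommGroup X] [InnerProductSpace ℝ X] [CompleteSpace X]
    (g : X → ℝ) (α a β h q p : ℝ) (δ : ℕ → ℝ) (x : ℕ → X) : Prop :=
  ∀ k : ℕ, 1 ≤ k →
    IsProx (stepSize α a β h q p δ k) g
      (x k + inertialParam α a h q p k • (x k - x (k - 1) + (β * h) • gradient g (x k))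
        - (h ^ 2 * inertialParam α a h q p k * tikhonovParam a h p k) • x k)
      (x (k + 1))

/-- The growth condition: there is `c > 0` such that
`δ_{k+1} ≤ k^p / ((1 + c) k^p - c (k+1)^p) * δ_k` for all large `k`
(the denominator is positive for all large `k`). -/
def GrowthCondition (p : ℝ) (δ : ℕ → ℝ) : Prop :=
  ∃ c : ℝ, 0 < c ∧ ∀ᶠ k : ℕ in atTop,
    δ (k + 1) ≤
      (k : ℝ) ^ p / ((1 + c) * (k : ℝ) ^ p - c * ((k : ℝ) + 1) ^ p) * δ k

end

/-!
Writing the proximal step as its optimality condition turns (IPGA) into an implicit inertial scheme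
for the velocity `v_k = x_k - x_{k-1} + b ∇g(x_k)`, with damping `γ_k` of order `k^(-q)`, objective
weight `D_k = h² δ_k` and regularization `A_k` of order `k^(-p)`. Let `z_k` be the Tikhonov point.
Along the scheme the Lyapunov function
`D_k (g(x_k) - g(z_k)) + A_k / 2 (‖x_k‖² - ‖z_k‖²) + ‖γ_k / 2 (x_k - z_k) + v_k‖² / 2
+ γ_k² / 8 ‖x_k - z_k‖²`
is contracted by a factor `1 - c k^(-m)` with `m = max q (p - q)`, up to errors of order `k^(-1-p)`
(from the variation of the parameters) and `k^(m-2-2q)` (from the motion of `z_k`). A discrete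
Gronwall inequality makes it `O(k^(-ω))` with `ω = min (1 + p - m) (2 + 2 q - 2 m)`; the three cases
of the theorem are the three values of `ω`.
-/

section ConvexAnalysis

theorem cauchySeq_of_dist_sq_le_tendsto_zero {Y : Type*} [PseudoMetricSpace Y] {u : ℕ → Y}
    {b : ℕ → ℝ} (h : ∀ m n, m ≤ n → dist (u m) (u n) ^ 2 ≤ b m) (hb : Tendsto b atTop (𝓝 0)) :
    CauchySeq u :=
  cauchySeq_of_le_tendsto_0' (fun n => √(b n)) (fun m n hmn => Real.le_sqrt_of_sq_le (h m n hmn))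
    (by simpa using hb.sqrt)

theorem existsUnique_isMinOn_of_strongConvexOn {E : Type*} [NormedAddCommGroup E]
    [NormedSpace ℝ E] {s : Set E} {f : E → ℝ} {m : ℝ} (hm : 0 < m) (hf : StrongConvexOn s m f)
    (hlsc : LowerSemicontinuousOn f s) (hbdd : BddBelow (f '' s)) (hs : IsComplete s)
    (hne : s.Nonempty) : ∃! z, z ∈ s ∧ IsMinOn f s z := by
  set μ := sInf (f '' s)
  have hμ : ∀ x ∈ s, μ ≤ f x := fun x hx => csInf_le hbdd ⟨x, hx, rfl⟩
  have hmid : ∀ x ∈ s, ∀ y ∈ s, dist x y ^ 2 ≤ 4 / m * (f x + f y - 2 * μ) := by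
    intro x hx y hy
    have hhalf : (0 : ℝ) ≤ 2⁻¹ := by norm_num
    have hadd : (2⁻¹ : ℝ) + 2⁻¹ = 1 := by norm_num
    have hconv := hf.2 hx hy hhalf hhalf hadd
    have hle := hμ _ (hf.1 hx hy hhalf hhalf hadd)
    rw [div_mul_eq_mul_div, le_div_iff₀ hm, dist_eq_norm]
    simp only [smul_eq_mul] at hconv
    linarith
  have hlt : ∀ n : ℕ, ∃ x ∈ s, f x < μ + 1 / ((n : ℝ) + 1) := fun n => by
    simpa using exists_lt_of_csInf_lt (hne.image f)
      (lt_add_of_pos_right μ (by positivity : 0 < 1 / ((n : ℝ) + 1)))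
  choose u hus hu using hlt
  have hcauchy : CauchySeq u := by
    refine cauchySeq_of_dist_sq_le_tendsto_zero (b := fun n : ℕ => 8 / m * (1 / ((n : ℝ) + 1)))
      (fun k n hkn => (hmid _ (hus k) _ (hus n)).trans ?_)
      (by simpa using (tendsto_one_div_add_atTop_nhds_zero_nat (𝕜 := ℝ)).const_mul (8 / m))
    have hmono : 1 / ((n : ℝ) + 1) ≤ 1 / ((k : ℝ) + 1) := by gcongr
    calc 4 / m * (f (u k) + f (u n) - 2 * μ) ≤ 4 / m * (2 * (1 / ((k : ℝ) + 1))) := by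
          gcongr; linarith [hu k, hu n]
      _ = 8 / m * (1 / ((k : ℝ) + 1)) := by ring
  obtain ⟨z, hz, hlim⟩ := cauchySeq_tendsto_of_isComplete hs hus hcauchy
  have hzμ : f z ≤ μ := by
    by_contra! hlt
    obtain ⟨c, hμc, hcz⟩ := exists_between hlt
    have hnhds : Tendsto u atTop (𝓝[s] z) :=
      tendsto_nhdsWithin_iff.2 ⟨hlim, Eventually.of_forall hus⟩
    have hsmall : ∀ᶠ n : ℕ in atTop, 1 / ((n : ℝ) + 1) < c - μ :=
      tendsto_one_div_add_atTop_nhds_zero_nat.eventually_lt_const (sub_pos.2 hμc)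
    obtain ⟨n, hcn, hn⟩ := ((hnhds.eventually (hlsc z hz c hcz)).and hsmall).exists
    linarith [hu n]
  have hzmin : IsMinOn f s z := fun y hy => hzμ.trans (hμ y hy)
  exact ⟨z, ⟨hz, hzmin⟩, fun y hy => (hf.strictConvexOn hm).eq_of_isMinOn hy.2 hzmin hy.1 hz⟩

theorem bddBelow_range_of_mem_argminSet {Y : Type*} {g : Y → ℝ} {s : Y} (hs : s ∈ argminSet g) :
    BddBelow (Set.range g) :=
  ⟨g s, Set.forall_mem_range.2 fun y => hs (Set.mem_univ y)⟩

theorem convex_argminSet {E : Type*} [AddCommGroup E] [Module ℝ E] {g : E → ℝ}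
    (hg : ConvexOn ℝ Set.univ g) : Convex ℝ (argminSet g) := by
  have heq : argminSet g = ⋂ y, {x ∈ Set.univ | g x ≤ g y} := by
    ext x; simp [argminSet, isMinOn_iff]
  exact heq ▸ convex_iInter fun y => hg.convex_le (g y)

theorem isClosed_argminSet {E : Type*} [TopologicalSpace E] {g : E → ℝ}
    (hg : LowerSemicontinuous g) : IsClosed (argminSet g) := by
  have heq : argminSet g = ⋂ y, g ⁻¹' Set.Iic (g y) := by
    ext x; simp [argminSet, isMinOn_iff]
  exact heq ▸ isClosed_iInter fun y => hg.isClosed_preimage (g y)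

variable {X : Type*} [NormedAddCommGroup X] [InnerProductSpace ℝ X]

theorem strongConvexOn_add_mul_norm_sq {s : Set X} {g : X → ℝ} (hg : ConvexOn ℝ s g) (ε : ℝ) :
    StrongConvexOn s ε fun x => g x + ε / 2 * ‖x‖ ^ 2 :=
  strongConvexOn_iff_convex.2 (by simpa using hg)

theorem existsUnique_isMinNormSolution [CompleteSpace X] {g : X → ℝ}
    (hg : ConvexOn ℝ Set.univ g) (hc : LowerSemicontinuous g) (hs : (argminSet g).Nonempty) :
    ∃! z, IsMinNormSolution g z := by
  have hsq : StrongConvexOn (argminSet g) 2 fun x : X => ‖x‖ ^ 2 := by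
    simpa using strongConvexOn_add_mul_norm_sq (convexOn_const 0 (convex_argminSet hg)) 2
  have hbdd : BddBelow ((fun x : X => ‖x‖ ^ 2) '' argminSet g) :=
    ⟨0, by rintro _ ⟨x, -, rfl⟩; positivity⟩
  simpa [IsMinNormSolution, isMinOn_iff, pow_le_pow_iff_left₀] using
    existsUnique_isMinOn_of_strongConvexOn two_pos hsq
      ((by fun_prop : Continuous fun x : X => ‖x‖ ^ 2).lowerSemicontinuous.lowerSemicontinuousOn _)
      hbdd (isClosed_argminSet hc).isComplete hs

theorem existsUnique_isTikhonovPoint [CompleteSpace X] {g : X → ℝ}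
    (hg : ConvexOn ℝ Set.univ g) (hc : LowerSemicontinuous g) (hbdd : BddBelow (Set.range g))
    {ε : ℝ} (hε : 0 < ε) : ∃! z, IsTikhonovPoint g ε z := by
  have hlsc : LowerSemicontinuous fun x => g x + ε / 2 * ‖x‖ ^ 2 :=
    hc.add (by fun_prop : Continuous fun x : X => ε / 2 * ‖x‖ ^ 2).lowerSemicontinuous
  have hbdd' : BddBelow ((fun x => g x + ε / 2 * ‖x‖ ^ 2) '' Set.univ) := by
    obtain ⟨c, hc⟩ := hbdd
    refine ⟨c, ?_⟩
    rintro _ ⟨x, -, rfl⟩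
    exact (hc ⟨x, rfl⟩).trans (le_add_of_nonneg_right (by positivity))
  simpa [IsTikhonovPoint] using existsUnique_isMinOn_of_strongConvexOn hε
    (strongConvexOn_add_mul_norm_sq hg ε) (hlsc.lowerSemicontinuousOn _) hbdd' isComplete_univ
    Set.univ_nonempty

theorem add_inner_sub_le_of_convexOn [CompleteSpace X] {s : Set X} {g : X → ℝ} {x y g' : X}
    (hg : ConvexOn ℝ s g) (hx : x ∈ s) (hy : y ∈ s) (hd : HasGradientAt g g' x) :
    g x + inner ℝ g' (y - x) ≤ g y := by
  let line : ℝ →ᵃ[ℝ] X := AffineMap.lineMap x y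
  have hderiv : HasDerivAt (g ∘ line) (inner ℝ g' (y - x)) 0 := by
    have hfderiv : HasFDerivAt g (InnerProductSpace.toDual ℝ X g') (line 0) := by
      simpa [line] using hd.hasFDerivAt
    exact hfderiv.comp_hasDerivAt 0 AffineMap.hasDerivAt_lineMap
  have hslope := (hg.comp_affineMap line).le_slope_of_hasDerivAt (x := 0) (y := 1)
    (by simpa [line]) (by simpa [line]) zero_lt_one hderiv
  simp only [slope, sub_zero, inv_one, one_smul, Function.comp_apply, vsub_eq_sub, line,
    AffineMap.lineMap_apply_one, AffineMap.lineMap_apply_zero] at hslope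
  linarith

theorem hasGradientAt_div_two_mul_norm_sub_sq [CompleteSpace X] (c : ℝ) (z u : X) :
    HasGradientAt (fun w : X => c / 2 * ‖w - z‖ ^ 2) (c • (u - z)) u := by
  rw [hasGradientAt_iff_hasFDerivAt]
  refine ((((hasFDerivAt_id (𝕜 := ℝ) u).sub_const z).norm_sq).const_mul (c / 2)).congr_fderiv ?_
  ext y
  simp
  ring

theorem gradient_add_smul_sub_eq_zero_of_isMinOn [CompleteSpace X] {g : X → ℝ} {c : ℝ} {z u : X}
    (hd : DifferentiableAt ℝ g u)
    (h : IsMinOn (fun w => g w + c / 2 * ‖w - z‖ ^ 2) Set.univ u) :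
    gradient g u + c • (u - z) = 0 := by
  have hderiv := hd.hasGradientAt.hasFDerivAt.add
    (hasGradientAt_div_two_mul_norm_sub_sq c z u).hasFDerivAt
  have hzero := (h.isLocalMin univ_mem).hasFDerivAt_eq_zero hderiv
  rw [← map_add] at hzero
  exact (LinearIsometryEquiv.map_eq_zero_iff _).1 hzero

theorem IsTikhonovPoint.gradient_eq [CompleteSpace X] {g : X → ℝ} {ε : ℝ} {z : X}
    (h : IsTikhonovPoint g ε z) (hd : DifferentiableAt ℝ g z) : gradient g z = -(ε • z) := by
  have hmin : IsMinOn (fun w => g w + ε / 2 * ‖w - 0‖ ^ 2) Set.univ z := by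
    simpa [IsTikhonovPoint] using h
  simpa using eq_neg_of_add_eq_zero_left (gradient_add_smul_sub_eq_zero_of_isMinOn hd hmin)

theorem IsProx.add_smul_gradient_eq [CompleteSpace X] {g : X → ℝ} {ρ : ℝ} {z u : X}
    (h : IsProx ρ g z u) (hρ : ρ ≠ 0) (hd : DifferentiableAt ℝ g u) :
    u + ρ • gradient g u = z := by
  have hmin : IsMinOn (fun w => g w + ρ⁻¹ / 2 * ‖w - z‖ ^ 2) Set.univ u := by
    simpa [IsProx, mul_comm, div_eq_mul_inv] using h
  have hgrad := eq_neg_of_add_eq_zero_left (gradient_add_smul_sub_eq_zero_of_isMinOn hd hmin)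
  rw [hgrad, smul_neg, smul_inv_smul₀ hρ]
  abel

theorem IsTikhonovPoint.norm_le {Y : Type*} [NormedAddCommGroup Y] {g : Y → ℝ} {ε : ℝ} {z s : Y}
    (h : IsTikhonovPoint g ε z) (hε : 0 < ε) (hs : s ∈ argminSet g) : ‖z‖ ≤ ‖s‖ := by
  have hreg : g z + ε / 2 * ‖z‖ ^ 2 ≤ g s + ε / 2 * ‖s‖ ^ 2 := h (Set.mem_univ s)
  have hmin : g s ≤ g z := hs (Set.mem_univ z)
  have hsq : ε / 2 * ‖z‖ ^ 2 ≤ ε / 2 * ‖s‖ ^ 2 := by linarith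
  exact le_of_sq_le_sq (le_of_mul_le_mul_left hsq (by positivity)) (norm_nonneg _)

section TikhonovPath

variable [CompleteSpace X] {g : X → ℝ} {ε ε' : ℝ} {z z' : X}

theorem IsTikhonovPoint.inner_smul_sub_smul_nonpos (h : IsTikhonovPoint g ε z)
    (h' : IsTikhonovPoint g ε' z') (hg : ConvexOn ℝ Set.univ g) (hd : Differentiable ℝ g) :
    inner ℝ (ε • z - ε' • z') (z - z') ≤ 0 := by
  have hle := add_inner_sub_le_of_convexOn hg trivial (Set.mem_univ z') (hd z).hasGradientAt
  have hle' := add_inner_sub_le_of_convexOn hg trivial (Set.mem_univ z) (hd z').hasGradientAt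
  rw [h.gradient_eq (hd z)] at hle
  rw [h'.gradient_eq (hd z')] at hle'
  simp only [inner_neg_left, inner_sub_left, inner_sub_right] at *
  linarith

theorem IsTikhonovPoint.mul_norm_sub_le (h : IsTikhonovPoint g ε z) (h' : IsTikhonovPoint g ε' z')
    (hg : ConvexOn ℝ Set.univ g) (hd : Differentiable ℝ g) :
    ε * ‖z - z'‖ ≤ |ε' - ε| * ‖z'‖ := by
  rcases eq_or_ne z z' with rfl | hne
  · simpa using by positivity
  have hmono := h.inner_smul_sub_smul_nonpos h' hg hd
  rw [show ε • z - ε' • z' = ε • (z - z') - (ε' - ε) • z' by module, inner_sub_left,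
    real_inner_smul_left, real_inner_smul_left, real_inner_self_eq_norm_sq, sub_nonpos] at hmono
  have hcs : (ε' - ε) * inner ℝ z' (z - z') ≤ |ε' - ε| * (‖z'‖ * ‖z - z'‖) :=
    (le_abs_self _).trans ((abs_mul _ _).trans_le (by gcongr; exact abs_real_inner_le_norm _ _))
  refine le_of_mul_le_mul_right ?_ (norm_pos_iff.2 (sub_ne_zero.2 hne))
  linarith

theorem IsTikhonovPoint.norm_sub_sq_le (h : IsTikhonovPoint g ε z) (h' : IsTikhonovPoint g ε' z')
    (hg : ConvexOn ℝ Set.univ g) (hd : Differentiable ℝ g) (hε' : 0 < ε') (hle : ε' ≤ ε) :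
    ‖z - z'‖ ^ 2 ≤ ‖z'‖ ^ 2 - ‖z‖ ^ 2 := by
  have hmono := h.inner_smul_sub_smul_nonpos h' hg hd
  rcases hle.eq_or_lt with rfl | hlt
  · rw [← smul_sub, real_inner_smul_left, real_inner_self_eq_norm_sq] at hmono
    have hzero : ‖z - z'‖ ^ 2 ≤ 0 := le_of_mul_le_mul_left (by simpa using hmono) hε'
    obtain rfl : z = z' := by simpa [sub_eq_zero] using hzero
    simp
  · rw [show ε • z - ε' • z' = (ε - ε') • z + ε' • (z - z') by module, inner_add_left,
      real_inner_smul_left, real_inner_smul_left, real_inner_self_eq_norm_sq] at hmono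
    have hinner : inner ℝ z (z - z') ≤ 0 := by
      refine le_of_mul_le_mul_left (?_ : (ε - ε') * _ ≤ (ε - ε') * 0) (sub_pos.2 hlt)
      linarith [mul_nonneg hε'.le (sq_nonneg ‖z - z'‖)]
    rw [inner_sub_right, real_inner_self_eq_norm_sq] at hinner
    rw [norm_sub_sq_real]
    linarith

theorem tendsto_of_isTikhonovPoint {ε : ℕ → ℝ} {z : ℕ → X} {s : X}
    (hg : ConvexOn ℝ Set.univ g) (hd : Differentiable ℝ g) (hs : IsMinNormSolution g s)
    (hε : ∀ k, 0 < ε k) (hanti : Antitone ε) (hlim : Tendsto ε atTop (𝓝 0))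
    (hz : ∀ k, IsTikhonovPoint g (ε k) (z k)) : Tendsto z atTop (𝓝 s) := by
  have hle : ∀ k, ‖z k‖ ≤ ‖s‖ := fun k => (hz k).norm_le (hε k) hs.1
  have hsq : ∀ m n, m ≤ n → ‖z m - z n‖ ^ 2 ≤ ‖z n‖ ^ 2 - ‖z m‖ ^ 2 := fun m n hmn =>
    (hz m).norm_sub_sq_le (hz n) hg hd (hε n) (hanti hmn)
  have hmono : Monotone fun k => ‖z k‖ ^ 2 := fun m n hmn =>
    sub_nonneg.1 ((sq_nonneg _).trans (hsq m n hmn))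
  have hbdd : BddAbove (Set.range fun k => ‖z k‖ ^ 2) :=
    ⟨‖s‖ ^ 2, by rintro _ ⟨k, rfl⟩; exact pow_le_pow_left₀ (norm_nonneg _) (hle k) 2⟩
  have hcauchy : CauchySeq z := by
    refine cauchySeq_of_dist_sq_le_tendsto_zero (b := fun m => (⨆ k, ‖z k‖ ^ 2) - ‖z m‖ ^ 2)
      (fun m n hmn => ?_)
      (sub_self (⨆ k, ‖z k‖ ^ 2) ▸ (tendsto_atTop_ciSup hmono hbdd).const_sub _)
    rw [dist_eq_norm]
    linarith [hsq m n hmn, le_ciSup hbdd n]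
  obtain ⟨l, hl⟩ := cauchySeq_tendsto_of_complete hcauchy
  have hval : ∀ k, g (z k) ≤ g s + ε k / 2 * ‖s‖ ^ 2 := fun k => by
    have hreg : g (z k) + ε k / 2 * ‖z k‖ ^ 2 ≤ g s + ε k / 2 * ‖s‖ ^ 2 := hz k (Set.mem_univ s)
    linarith [mul_nonneg (half_pos (hε k)).le (sq_nonneg ‖z k‖)]
  have hgl : g l ≤ g s := by
    refine le_of_tendsto_of_tendsto' ((hd.continuous.tendsto l).comp hl) ?_ hval
    simpa using ((hlim.div_const 2).mul_const (‖s‖ ^ 2)).const_add (g s)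
  have hlmin : IsMinNormSolution g l :=
    ⟨fun y _ => hgl.trans (hs.1 (Set.mem_univ y)), fun y hy =>
      (le_of_tendsto' hl.norm hle).trans (hs.2 y hy)⟩
  exact (existsUnique_isMinNormSolution hg hd.continuous.lowerSemicontinuous
    ⟨s, hs.1⟩).unique hlmin hs ▸ hl

end TikhonovPath

end ConvexAnalysis

section Lyapunov

variable {X : Type*} [NormedAddCommGroup X] [InnerProductSpace ℝ X]

theorem abs_inner_le_mul_norm_sq_add_norm_sq_div {t : ℝ} (ht : 0 < t) (x y : X) :
    |inner ℝ x y| ≤ t * ‖x‖ ^ 2 + ‖y‖ ^ 2 / (4 * t) := by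
  have hsq : 0 ≤ (2 * t * ‖x‖ - ‖y‖) ^ 2 / (4 * t) := by positivity
  calc |inner ℝ x y| ≤ ‖x‖ * ‖y‖ := abs_real_inner_le_norm x y
    _ = t * ‖x‖ ^ 2 + ‖y‖ ^ 2 / (4 * t) - (2 * t * ‖x‖ - ‖y‖) ^ 2 / (4 * t) := by
      field_simp
      ring
    _ ≤ t * ‖x‖ ^ 2 + ‖y‖ ^ 2 / (4 * t) := sub_le_self _ hsq

theorem norm_add_sq_le_one_add_mul {t : ℝ} (ht : 0 < t) (x y : X) :
    ‖x + y‖ ^ 2 ≤ (1 + t) * ‖x‖ ^ 2 + (1 + 1 / t) * ‖y‖ ^ 2 := by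
  have hyoung := (le_abs_self _).trans
    (abs_inner_le_mul_norm_sq_add_norm_sq_div (half_pos ht) x y)
  have hdiv : 2 * (‖y‖ ^ 2 / (4 * (t / 2))) = 1 / t * ‖y‖ ^ 2 := by
    field_simp
    ring
  rw [norm_add_sq_real]
  linarith

theorem norm_add_sq_le_two_mul (x y : X) : ‖x + y‖ ^ 2 ≤ 2 * ‖x‖ ^ 2 + 2 * ‖y‖ ^ 2 := by
  convert norm_add_sq_le_one_add_mul one_pos x y using 3 <;> norm_num

/-- The excess over `z` of the regularized objective `D g + (A / 2) ‖·‖²`; it is nonnegative when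
`z` is its minimizer. -/
noncomputable def tikhonovGap {Y : Type*} [NormedAddCommGroup Y] (g : Y → ℝ) (D A : ℝ)
    (z x : Y) : ℝ :=
  D * (g x - g z) + A / 2 * (‖x‖ ^ 2 - ‖z‖ ^ 2)

theorem IsTikhonovPoint.tikhonovGap_nonneg {Y : Type*} [NormedAddCommGroup Y] {g : Y → ℝ}
    {D A : ℝ} {z : Y} (hz : IsTikhonovPoint g (A / D) z) (hD : 0 < D) (x : Y) :
    0 ≤ tikhonovGap g D A z x := by
  have hle := mul_le_mul_of_nonneg_left (hz (Set.mem_univ x)) hD.le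
  have hcancel : D * (A / D) = A := mul_div_cancel₀ A hD.ne'
  unfold tikhonovGap
  linear_combination hle + (‖x‖ ^ 2 - ‖z‖ ^ 2) / 2 * hcancel

/-- The discrete Lyapunov function, where `e` stands for the gap in the regularized objective, `γ`
for the damping, `y` for the deviation from the regularized minimizer and `v` for the velocity. -/
noncomputable def lyapunov (e γ : ℝ) (y v : X) : ℝ :=
  e + 1 / 2 * ‖(γ / 2) • y + v‖ ^ 2 + γ ^ 2 / 8 * ‖y‖ ^ 2

theorem lyapunov_nonneg {e : ℝ} (he : 0 ≤ e) (γ : ℝ) (y v : X) : 0 ≤ lyapunov e γ y v := by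
  unfold lyapunov
  positivity

theorem le_lyapunov (e γ : ℝ) (y v : X) : e ≤ lyapunov e γ y v := by
  unfold lyapunov
  rw [add_assoc]
  exact le_add_of_nonneg_right (by positivity)

theorem mul_norm_sq_le_lyapunov {e : ℝ} (he : 0 ≤ e) (γ : ℝ) (y v : X) :
    γ ^ 2 / 8 * ‖y‖ ^ 2 ≤ lyapunov e γ y v := by
  unfold lyapunov
  exact le_add_of_nonneg_left (by positivity)

theorem norm_sq_le_lyapunov {e : ℝ} (he : 0 ≤ e) (γ : ℝ) (y v : X) :
    ‖v‖ ^ 2 ≤ 8 * lyapunov e γ y v := by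
  have hsplit := norm_add_sq_le_two_mul ((γ / 2) • y + v) (-((γ / 2) • y))
  rw [add_neg_cancel_comm, norm_neg, norm_smul, mul_pow, Real.norm_eq_abs, sq_abs] at hsplit
  unfold lyapunov
  linarith [sq_nonneg ‖(γ / 2) • y + v‖, mul_nonneg (sq_nonneg γ) (sq_nonneg ‖y‖)]

theorem lyapunov_le (e γ : ℝ) (y v : X) :
    lyapunov e γ y v ≤ e + 3 / 8 * γ ^ 2 * ‖y‖ ^ 2 + ‖v‖ ^ 2 := by
  have hsplit := norm_add_sq_le_two_mul ((γ / 2) • y) v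
  rw [norm_smul, mul_pow, Real.norm_eq_abs, sq_abs] at hsplit
  unfold lyapunov
  linarith

theorem lyapunov_add_dissipation_le {γ e e' : ℝ} {w y v v' P : X} (hv : v = v' + γ • w + P)
    (he : e' - e ≤ inner ℝ P w) :
    lyapunov e' γ y v' + (γ / 2 * inner ℝ w v' + γ / 2 * inner ℝ P y + inner ℝ P (v' - w)) ≤
      lyapunov e γ (y - w) v := by
  have hsplit : (γ / 2) • (y - w) + v = ((γ / 2) • y + v') + ((γ / 2) • w + P) := by
    rw [hv]; module
  have hinner : inner ℝ ((γ / 2) • y + v') ((γ / 2) • w + P) =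
      γ ^ 2 / 4 * inner ℝ y w + γ / 2 * inner ℝ P y + γ / 2 * inner ℝ w v' + inner ℝ P v' := by
    simp only [inner_add_left, inner_add_right, real_inner_smul_right, real_inner_comm P,
      real_inner_comm w]
    ring
  unfold lyapunov
  rw [hsplit, norm_add_sq_real _ ((γ / 2) • w + P), hinner, norm_sub_sq_real, inner_sub_right]
  linarith [sq_nonneg ‖(γ / 2) • w + P‖, mul_nonneg (sq_nonneg γ) (sq_nonneg ‖w‖)]

/-- `r` is a contraction rate of the energy along one step of the scheme with step coefficient `b`,
damping `γ`, and weights `D` of the objective and `A` of the regularization. The last two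
conditions, free of `r`, say that the coupling of the velocity with the gradient is harmless. -/
structure IsContractionRate (b γ D A r : ℝ) : Prop where
  pos : 0 < r
  le_one : r ≤ 1
  eight_mul_le : 8 * r ≤ γ
  three_mul_mul_le : 3 * r * γ ≤ A
  four_mul_mul_le : 4 * r * b ≤ D
  mul_le : γ * b ≤ D
  sixteen_mul_mul_le : 16 * b * A ≤ γ * D

theorem neg_mul_inner_add_le {b γ D A r : ℝ} (hr : IsContractionRate b γ D A r) (hb : 0 < b)
    (hA : 0 < A) (hD : 0 < D) (y z G : X) :
    -(b * A * inner ℝ (y + z) G) ≤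
      γ * A / 8 * ‖y‖ ^ 2 + 2 * b * A ^ 2 / D * ‖z‖ ^ 2 + b * D / 4 * ‖G‖ ^ 2 := by
  have hinner : -(b * A * inner ℝ (y + z) G) ≤
      b * A ^ 2 / D * ‖y + z‖ ^ 2 + b * D / 4 * ‖G‖ ^ 2 := by
    have hyoung := (neg_le_abs _).trans
      (abs_inner_le_mul_norm_sq_add_norm_sq_div (by positivity : 0 < A / D) (y + z) G)
    have hscale := mul_le_mul_of_nonneg_left hyoung (by positivity : 0 ≤ b * A)
    have heq : b * A * (A / D * ‖y + z‖ ^ 2 + ‖G‖ ^ 2 / (4 * (A / D))) =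
        b * A ^ 2 / D * ‖y + z‖ ^ 2 + b * D / 4 * ‖G‖ ^ 2 := by
      field_simp
    linarith
  have hyz : b * A ^ 2 / D * ‖y + z‖ ^ 2 ≤
      γ * A / 8 * ‖y‖ ^ 2 + 2 * b * A ^ 2 / D * ‖z‖ ^ 2 := by
    have hcoeff : 2 * (b * A ^ 2 / D) ≤ γ * A / 8 := by
      rw [← mul_div_assoc, div_le_iff₀ hD]
      linarith [mul_le_mul_of_nonneg_left hr.sixteen_mul_mul_le hA.le]
    calc b * A ^ 2 / D * ‖y + z‖ ^ 2
        ≤ b * A ^ 2 / D * (2 * ‖y‖ ^ 2 + 2 * ‖z‖ ^ 2) := by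
          gcongr; exact norm_add_sq_le_two_mul y z
      _ = 2 * (b * A ^ 2 / D) * ‖y‖ ^ 2 + 2 * b * A ^ 2 / D * ‖z‖ ^ 2 := by ring
      _ ≤ γ * A / 8 * ‖y‖ ^ 2 + 2 * b * A ^ 2 / D * ‖z‖ ^ 2 := by gcongr
  linarith

theorem dissipation_ge {b γ D A r e : ℝ} {w y z G P : X} (hr : IsContractionRate b γ D A r)
    (hb : 0 < b) (hA : 0 < A) (hD : 0 < D) (hP : P = D • G + A • (y + z))
    (he : e + A / 2 * ‖y‖ ^ 2 ≤ inner ℝ P y) :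
    γ / 4 * ‖w‖ ^ 2 + γ / 2 * e + γ * A / 8 * ‖y‖ ^ 2 + b * D / 2 * ‖G‖ ^ 2
        - 2 * b * A ^ 2 / D * ‖z‖ ^ 2 ≤
      γ / 2 * inner ℝ w (w + b • G) + γ / 2 * inner ℝ P y + inner ℝ P (b • G) := by
  have hγ : 0 < γ := by linarith [hr.pos, hr.eight_mul_le]
  have hwG : -(γ * b / 2 * inner ℝ w G) ≤ γ / 4 * ‖w‖ ^ 2 + b * D / 4 * ‖G‖ ^ 2 := by
    have hyoung := (neg_le_abs _).trans
      (abs_inner_le_mul_norm_sq_add_norm_sq_div (by positivity : 0 < 1 / (2 * b)) w G)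
    have hscale := mul_le_mul_of_nonneg_left hyoung (by positivity : 0 ≤ γ * b / 2)
    have hcoeff := mul_le_mul_of_nonneg_right hr.mul_le (by positivity : 0 ≤ b / 4 * ‖G‖ ^ 2)
    have heq : γ * b / 2 * (1 / (2 * b) * ‖w‖ ^ 2 + ‖G‖ ^ 2 / (4 * (1 / (2 * b)))) =
        γ / 4 * ‖w‖ ^ 2 + γ * b * (b / 4 * ‖G‖ ^ 2) := by
      field_simp
      ring
    linarith
  have hyG := neg_mul_inner_add_le hr hb hA hD y z G
  have hPG : inner ℝ P (b • G) = b * D * ‖G‖ ^ 2 + b * A * inner ℝ (y + z) G := by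
    rw [hP, real_inner_smul_right, inner_add_left, real_inner_smul_left, real_inner_smul_left,
      real_inner_self_eq_norm_sq]
    ring
  have hww : inner ℝ w (w + b • G) = ‖w‖ ^ 2 + b * inner ℝ w G := by
    rw [inner_add_right, real_inner_smul_right, real_inner_self_eq_norm_sq]
  rw [hPG, hww]
  linarith [mul_le_mul_of_nonneg_left he (half_pos hγ).le]

theorem one_add_mul_lyapunov_le {b γ D A r e e' : ℝ} {w y z v G : X}
    (hr : IsContractionRate b γ D A r) (hb : 0 < b) (hA : 0 < A) (hD : 0 < D)
    (hv : v = (w + b • G) + γ • w + (D • G + A • (y + z)))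
    (he : e' - e ≤ inner ℝ (D • G + A • (y + z)) w)
    (he' : e' + A / 2 * ‖y‖ ^ 2 ≤ inner ℝ (D • G + A • (y + z)) y) (he0 : 0 ≤ e') :
    (1 + r) * lyapunov e' γ y (w + b • G) ≤
      lyapunov e γ (y - w) v + 2 * b * A ^ 2 / D * ‖z‖ ^ 2 := by
  have hdecrease := lyapunov_add_dissipation_le (y := y) hv he
  rw [add_sub_cancel_left] at hdecrease
  have hdiss := dissipation_ge (w := w) hr hb hA hD rfl he'
  have hγ : 0 < γ := by linarith [hr.pos, hr.eight_mul_le]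
  have hvel : ‖w + b • G‖ ^ 2 ≤ 2 * ‖w‖ ^ 2 + 2 * b ^ 2 * ‖G‖ ^ 2 := by
    refine (norm_add_sq_le_two_mul w (b • G)).trans_eq ?_
    rw [norm_smul, mul_pow, Real.norm_eq_abs, sq_abs, mul_assoc]
  have hup := mul_le_mul_of_nonneg_left
    ((lyapunov_le e' γ y (w + b • G)).trans (add_le_add_right hvel _)) hr.pos.le
  have hgap : r * e' ≤ γ / 2 * e' := by gcongr; linarith [hr.pos, hr.eight_mul_le]
  have hpos := mul_le_mul_of_nonneg_right hr.three_mul_mul_le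
    (by positivity : 0 ≤ γ / 8 * ‖y‖ ^ 2)
  have hincr := mul_le_mul_of_nonneg_right hr.eight_mul_le (by positivity : 0 ≤ 1 / 4 * ‖w‖ ^ 2)
  have hgrad := mul_le_mul_of_nonneg_right hr.four_mul_mul_le
    (by positivity : 0 ≤ b / 2 * ‖G‖ ^ 2)
  linarith

theorem norm_add_sq_le_of_le_one {r : ℝ} (hr : 0 < r) (hr1 : r ≤ 1) (u c : X) :
    ‖u + c‖ ^ 2 ≤ (1 + r / 4) * ‖u‖ ^ 2 + 5 / r * ‖c‖ ^ 2 := by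
  refine (norm_add_sq_le_one_add_mul (by positivity : 0 < r / 4) u c).trans ?_
  gcongr
  rw [one_div_div, le_div_iff₀ hr, add_mul, div_mul_cancel₀ _ hr.ne']
  linarith

theorem norm_smul_add_sq_le_of_parameter_change {γ γ' r κ ζ : ℝ} {x z z' v : X} (hr : 0 < r)
    (hr1 : r ≤ 1) (hκ : 0 ≤ κ) (hκr : 8 * κ ≤ r) (hγ' : 0 ≤ γ') (hγ : γ' ≤ γ)
    (hγκ : (1 - κ) * γ ≤ γ') (hz : ‖z - z'‖ ≤ ζ) :
    ‖(γ' / 2) • (x - z') + v‖ ^ 2 ≤ (1 + r / 4) * ‖(γ / 2) • (x - z) + v‖ ^ 2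
      + 5 / 128 * r * γ ^ 2 * ‖x - z‖ ^ 2 + 5 / 2 * γ ^ 2 * ζ ^ 2 / r := by
  set c : X := ((γ' - γ) / 2) • (x - z) + (γ' / 2) • (z - z') with hc
  have hvel := norm_add_sq_le_of_le_one hr hr1 ((γ / 2) • (x - z) + v) c
  rw [show (γ / 2) • (x - z) + v + c = (γ' / 2) • (x - z') + v by rw [hc]; module] at hvel
  have hcsq : ‖c‖ ^ 2 ≤ 2 * ((κ * γ / 2) ^ 2 * ‖x - z‖ ^ 2) + 2 * ((γ / 2) ^ 2 * ζ ^ 2) := by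
    refine (norm_add_sq_le_two_mul _ _).trans ?_
    rw [norm_smul, norm_smul, mul_pow, mul_pow, Real.norm_eq_abs, sq_abs, Real.norm_eq_abs, sq_abs]
    have hdamp : ((γ' - γ) / 2) ^ 2 ≤ (κ * γ / 2) ^ 2 := by
      apply sq_le_sq' <;> linarith
    gcongr
  have hκsq : 5 / r * κ ^ 2 ≤ 5 / 64 * r := by
    rw [div_mul_eq_mul_div, div_le_iff₀ hr]
    nlinarith
  have hcross := mul_le_mul_of_nonneg_right hκsq (by positivity : 0 ≤ γ ^ 2 / 2 * ‖x - z‖ ^ 2)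
  have hcscaled := mul_le_mul_of_nonneg_left hcsq (by positivity : 0 ≤ 5 / r)
  linear_combination hvel + hcscaled + hcross

theorem lyapunov_le_of_parameter_change {γ γ' e e' r κ ζ η : ℝ} {x z z' v : X} (he : 0 ≤ e)
    (hr : 0 < r) (hr1 : r ≤ 1) (hκ : 0 ≤ κ) (hκr : 8 * κ ≤ r) (hγ' : 0 ≤ γ') (hγ : γ' ≤ γ)
    (hγκ : (1 - κ) * γ ≤ γ') (hz : ‖z - z'‖ ≤ ζ) (hee : e' ≤ (1 + κ) * e + η) :
    lyapunov e' γ' (x - z') v ≤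
      (1 + r / 2) * lyapunov e γ (x - z) v + η + 2 * γ ^ 2 * ζ ^ 2 / r := by
  have hζ : ‖z - z'‖ ^ 2 ≤ ζ ^ 2 := by gcongr
  have hpos : γ' ^ 2 / 8 * ‖x - z'‖ ^ 2 ≤
      γ ^ 2 / 8 * ((1 + r / 4) * ‖x - z‖ ^ 2 + 5 / r * ζ ^ 2) := by
    have hxz := norm_add_sq_le_of_le_one hr hr1 (x - z) (z - z')
    rw [sub_add_sub_cancel] at hxz
    gcongr
    exact hxz.trans (by gcongr)
  have hvel := norm_smul_add_sq_le_of_parameter_change (x := x) (v := v) hr hr1 hκ hκr hγ' hγ hγκ hz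
  have herr0 : 0 ≤ 1 / r * (γ ^ 2 * ζ ^ 2) := by positivity
  have hgap : κ * e ≤ r / 2 * e := by gcongr; linarith
  have hmix0 : 0 ≤ r * ‖(γ / 2) • (x - z) + v‖ ^ 2 := by positivity
  have hpos0 : 0 ≤ r * (γ ^ 2 * ‖x - z‖ ^ 2) := by positivity
  unfold lyapunov
  linear_combination hee + hgap + hpos + 1 / 2 * hvel + 1 / 8 * herr0
    + 1 / 8 * hmix0 + 3 / 256 * hpos0

variable [CompleteSpace X] {g : X → ℝ}

theorem tikhonovGap_add_mul_norm_sq_le {D A : ℝ} (hg : ConvexOn ℝ Set.univ g)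
    (hd : Differentiable ℝ g) (hD : 0 ≤ D) (z x y : X) :
    tikhonovGap g D A z x + A / 2 * ‖x - y‖ ^ 2 ≤
      tikhonovGap g D A z y + inner ℝ (D • gradient g x + A • x) (x - y) := by
  have hconv := mul_le_mul_of_nonneg_left
    (add_inner_sub_le_of_convexOn hg trivial (Set.mem_univ y) (hd x).hasGradientAt) hD
  rw [← neg_sub x y, inner_neg_right] at hconv
  rw [inner_add_left, real_inner_smul_left, real_inner_smul_left, inner_sub_right x,
    real_inner_self_eq_norm_sq, norm_sub_sq_real]
  unfold tikhonovGap
  linarith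

theorem mul_norm_sub_sq_le_tikhonovGap {D A : ℝ} (hg : ConvexOn ℝ Set.univ g)
    (hd : Differentiable ℝ g) (hD : 0 < D) {z : X} (hz : IsTikhonovPoint g (A / D) z) (x : X) :
    A / 2 * ‖x - z‖ ^ 2 ≤ tikhonovGap g D A z x := by
  have hle := tikhonovGap_add_mul_norm_sq_le (A := A) hg hd hD.le z z x
  rw [hz.gradient_eq (hd z), smul_neg, smul_smul, mul_div_cancel₀ _ hD.ne', neg_add_cancel,
    inner_zero_left, norm_sub_rev] at hle
  simpa [tikhonovGap] using hle

/-- The parameters `γ`, `D`, `A` change by a relative amount at most `κ` to the new values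
`γ'`, `D'`, `A'`, with `γ` and `A` decreasing and `D` increasing. -/
structure SlowVariation (κ γ D A γ' D' A' : ℝ) : Prop where
  damping_pos : 0 < γ'
  damping_le : γ' ≤ γ
  le_damping : (1 - κ) * γ ≤ γ'
  weight_pos : 0 < D
  weight_le : D ≤ D'
  le_weight : D' ≤ (1 + κ) * D
  regularization_pos : 0 < A'
  regularization_le : A' ≤ A
  le_regularization : (1 - κ) * A ≤ A'

variable {κ γ D A γ' D' A' : ℝ} {s z z' : X}

theorem SlowVariation.rate_nonneg (h : SlowVariation κ γ D A γ' D' A') : 0 ≤ κ := by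
  have hle : 0 ≤ κ * D := by linarith [h.weight_le, h.le_weight]
  exact nonneg_of_mul_nonneg_left hle h.weight_pos

theorem SlowVariation.norm_sub_le (h : SlowVariation κ γ D A γ' D' A')
    (hg : ConvexOn ℝ Set.univ g) (hd : Differentiable ℝ g) (hs : s ∈ argminSet g)
    (hz : IsTikhonovPoint g (A / D) z) (hz' : IsTikhonovPoint g (A' / D') z') :
    ‖z - z'‖ ≤ 2 * κ * ‖s‖ := by
  have hD := h.weight_pos
  have hD' : 0 < D' := hD.trans_le h.weight_le
  have hA' := h.regularization_pos
  have hA : 0 < A := hA'.trans_le h.regularization_le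
  have hle : A' / D' ≤ A / D := div_le_div₀ hA.le h.regularization_le hD h.weight_le
  have hge : (1 - 2 * κ) * (A / D) ≤ A' / D' := by
    rw [← mul_div_assoc, div_le_div_iff₀ hD hD']
    nlinarith [mul_le_mul_of_nonneg_left h.le_regularization hD.le,
      mul_le_mul_of_nonneg_left h.le_weight hA.le, h.rate_nonneg,
      mul_nonneg (mul_nonneg h.rate_nonneg hA.le) (sub_nonneg.2 h.weight_le),
      mul_pos hA hD]
  refine le_of_mul_le_mul_left (a := A / D) ?_ (by positivity)
  calc A / D * ‖z - z'‖ ≤ |A' / D' - A / D| * ‖z'‖ := hz.mul_norm_sub_le hz' hg hd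
    _ ≤ 2 * κ * (A / D) * ‖s‖ := by
      rw [abs_of_nonpos (by linarith)]
      exact mul_le_mul (by linarith) (hz'.norm_le (by positivity) hs) (norm_nonneg _)
        (mul_nonneg (mul_nonneg two_pos.le h.rate_nonneg) (by positivity))
    _ = A / D * (2 * κ * ‖s‖) := by ring

theorem SlowVariation.tikhonovGap_le {Y : Type*} [NormedAddCommGroup Y] {g : Y → ℝ} {s z : Y}
    (h : SlowVariation κ γ D A γ' D' A') (hκ : κ ≤ 1) (hs : s ∈ argminSet g)
    (hz : IsTikhonovPoint g (A / D) z) (z' x : Y) :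
    tikhonovGap g D' A' z' x ≤ (1 + κ) * tikhonovGap g D A z x + κ * A * ‖s‖ ^ 2 := by
  have hmin (y : Y) : 0 ≤ g y - g s := sub_nonneg.2 (hs (Set.mem_univ y))
  have hA : 0 < A := h.regularization_pos.trans_le h.regularization_le
  have hD0 : (1 - κ) * D ≤ D' := by
    linarith [h.weight_le, mul_nonneg h.rate_nonneg h.weight_pos.le]
  have hA0 : A' ≤ (1 + κ) * A := by
    linarith [h.regularization_le, mul_nonneg h.rate_nonneg hA.le]
  have hxD := mul_le_mul_of_nonneg_right h.le_weight (hmin x)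
  have hxA := mul_le_mul_of_nonneg_right hA0 (sq_nonneg ‖x‖)
  have hzD := mul_le_mul_of_nonneg_right hD0 (hmin z')
  have hzA := mul_le_mul_of_nonneg_right h.le_regularization (sq_nonneg ‖z'‖)
  have hgapz := mul_nonneg (sub_nonneg.2 hκ) (hz.tikhonovGap_nonneg h.weight_pos z')
  have hgaps := mul_nonneg h.rate_nonneg (hz.tikhonovGap_nonneg h.weight_pos s)
  unfold tikhonovGap at *
  linarith

theorem energy_succ_le {b r : ℝ} {x x' v : X} (hr : IsContractionRate b γ D A r)
    (h : SlowVariation κ γ D A γ' D' A') (hκ : 8 * κ ≤ r) (hb : 0 < b)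
    (hg : ConvexOn ℝ Set.univ g) (hd : Differentiable ℝ g) (hs : s ∈ argminSet g)
    (hz : IsTikhonovPoint g (A / D) z) (hz' : IsTikhonovPoint g (A' / D') z')
    (hv : v = (x' - x + b • gradient g x') + γ • (x' - x) + (D • gradient g x' + A • x')) :
    lyapunov (tikhonovGap g D' A' z' x') γ' (x' - z') (x' - x + b • gradient g x') ≤
      (1 - r / 4) * lyapunov (tikhonovGap g D A z x) γ (x - z) v
        + (2 * b * A ^ 2 / D + κ * A + 8 * γ ^ 2 * κ ^ 2 / r) * ‖s‖ ^ 2 := by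
  have hD := h.weight_pos
  have hA : 0 < A := h.regularization_pos.trans_le h.regularization_le
  have hr0 := hr.pos
  have hr1 := hr.le_one
  have hgap0 := hz.tikhonovGap_nonneg hD x'
  set L := lyapunov (tikhonovGap g D A z x') γ (x' - z) (x' - x + b • gradient g x')
  have hfrozen : (1 + r) * L ≤
      lyapunov (tikhonovGap g D A z x) γ (x - z) v + 2 * b * A ^ 2 / D * ‖z‖ ^ 2 := by
    have hincr := tikhonovGap_add_mul_norm_sq_le (A := A) hg hd hD.le z x' x
    have hdev := tikhonovGap_add_mul_norm_sq_le (A := A) hg hd hD.le z x' z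
    convert one_add_mul_lyapunov_le (w := x' - x) (y := x' - z) (z := z) (v := v)
      (e := tikhonovGap g D A z x) hr hb hA hD (by rwa [sub_add_cancel])
      ?_ ?_ hgap0 using 3
    · abel
    · rw [sub_add_cancel]
      linarith [(by positivity : 0 ≤ A / 2 * ‖x' - x‖ ^ 2)]
    · rw [sub_add_cancel]
      simpa [tikhonovGap] using hdev
  have hchange := lyapunov_le_of_parameter_change (x := x')
    (v := x' - x + b • gradient g x') hgap0 hr0 hr1
    h.rate_nonneg hκ h.damping_pos.le h.damping_le h.le_damping (h.norm_sub_le hg hd hs hz hz')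
    (h.tikhonovGap_le (by linarith) hs hz z' x')
  have hL : (1 + r / 2) * L ≤ (1 - r / 4) * ((1 + r) * L) := by
    rw [← mul_assoc]
    exact mul_le_mul_of_nonneg_right (by nlinarith) (lyapunov_nonneg hgap0 _ _ _)
  have hznorm : ‖z‖ ≤ ‖s‖ := hz.norm_le (by positivity) hs
  have herr : (1 - r / 4) * (2 * b * A ^ 2 / D * ‖z‖ ^ 2) ≤ 2 * b * A ^ 2 / D * ‖s‖ ^ 2 :=
    (mul_le_of_le_one_left (by positivity) (by linarith)).trans (by gcongr)
  have hcontract := hL.trans (mul_le_mul_of_nonneg_left hfrozen (by linarith : 0 ≤ 1 - r / 4))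
  linear_combination hchange + hcontract + herr

end Lyapunov

section PowerSequences

theorem one_sub_div_mul_rpow_neg_le {a t : ℝ} (ha : 0 ≤ a) (ht : 0 < t) :
    (1 - a / t) * t ^ (-a) ≤ (t + 1) ^ (-a) := by
  have hfactor : t + 1 = t * (1 + 1 / t) := by field_simp
  have hpos : 0 < 1 + 1 / t := by positivity
  have hlog : a * Real.log (1 + 1 / t) ≤ a * (1 / t) := by
    gcongr
    linarith [Real.log_le_sub_one_of_pos hpos]
  rw [hfactor, Real.mul_rpow ht.le hpos.le, mul_comm]
  gcongr
  rw [Real.rpow_def_of_pos hpos]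
  linarith [Real.add_one_le_exp (Real.log (1 + 1 / t) * -a), mul_one_div a t]

theorem tendsto_natCast_rpow_neg {a : ℝ} (ha : 0 < a) :
    Tendsto (fun k : ℕ => (k : ℝ) ^ (-a)) atTop (𝓝 0) :=
  (tendsto_rpow_neg_atTop ha).comp tendsto_natCast_atTop_atTop

theorem isBigO_natCast_rpow_rpow {a b : ℝ} (hab : a ≤ b) :
    (fun k : ℕ => (k : ℝ) ^ a) =O[atTop] fun k : ℕ => (k : ℝ) ^ b := by
  refine IsBigO.of_bound 1 ?_
  filter_upwards [eventually_ge_atTop 1] with k hk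
  rw [one_mul, Real.norm_of_nonneg (by positivity), Real.norm_of_nonneg (by positivity)]
  exact Real.rpow_le_rpow_of_exponent_le (by exact_mod_cast hk) hab

theorem isBigO_natCast_rpow_comp_succ_iff {E : Type*} [NormedAddCommGroup E] {f : ℕ → E} {a : ℝ} :
    (fun k => f (k + 1)) =O[atTop] (fun k : ℕ => (k : ℝ) ^ a) ↔
      f =O[atTop] (fun k : ℕ => (k : ℝ) ^ a) := by
  have hone : (fun _ : ℕ => (1 : ℝ)) =o[atTop] fun k : ℕ => (k : ℝ) :=
    isLittleO_const_left.2 (Or.inr (tendsto_norm_atTop_atTop.comp tendsto_natCast_atTop_atTop))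
  have hsucc : (fun k : ℕ => ((k + 1 : ℕ) : ℝ)) ~[atTop] fun k : ℕ => (k : ℝ) := by
    simp only [Nat.cast_add, Nat.cast_one]
    exact IsEquivalent.refl.add_isLittleO hone
  have hpow : (fun k : ℕ => ((k + 1 : ℕ) : ℝ) ^ a) =Θ[atTop] fun k : ℕ => (k : ℝ) ^ a :=
    hsucc.isTheta.rpow (Eventually.of_forall fun k => by positivity)
      (Eventually.of_forall fun k => by positivity)
  rw [← hpow.isBigO_congr_right]
  conv_rhs => rw [← map_add_atTop_eq_nat 1, isBigO_map]
  rfl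

theorem eventually_div_le_mul_rpow_neg (K : ℝ) {c m : ℝ} (hc : 0 < c) (hm : m < 1) :
    ∀ᶠ k : ℕ in atTop, K / k ≤ c * (k : ℝ) ^ (-m) := by
  have hlim : Tendsto (fun k : ℕ => (k : ℝ) ^ (1 - m)) atTop atTop :=
    (tendsto_rpow_atTop (by linarith)).comp tendsto_natCast_atTop_atTop
  filter_upwards [hlim.eventually_ge_atTop (K / c), eventually_gt_atTop 0] with k hk hk0
  have hk0 : (0 : ℝ) < k := by exact_mod_cast hk0
  rw [div_le_iff₀ hc] at hk
  rwa [div_le_iff₀ hk0, mul_assoc, ← Real.rpow_add_one hk0.ne', neg_add_eq_sub, mul_comm]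

theorem isBigO_natCast_rpow_of_mul {f w : ℕ → ℝ} {a b : ℝ}
    (hw : (fun k : ℕ => (k : ℝ) ^ a) =O[atTop] w)
    (hf : (fun k => w k * f k) =O[atTop] fun k : ℕ => (k : ℝ) ^ b) :
    f =O[atTop] fun k : ℕ => (k : ℝ) ^ (b - a) := by
  have hprod : (fun k : ℕ => (k : ℝ) ^ a * f k) =O[atTop] fun k : ℕ => (k : ℝ) ^ b :=
    (hw.mul (isBigO_refl f atTop)).trans hf
  refine ((isBigO_refl (fun k : ℕ => (k : ℝ) ^ (-a)) atTop).mul_atTop_rpow_natCast_of_isBigO_rpow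
    (-a) b (b - a) hprod (by linarith)).congr' ?_ .rfl
  filter_upwards [eventually_gt_atTop 0] with k hk
  rw [Pi.mul_apply, ← mul_assoc, ← Real.rpow_add (by exact_mod_cast hk), neg_add_cancel,
    Real.rpow_zero, one_mul]

theorem isBigO_natCast_rpow_half_of_sq {f : ℕ → ℝ} {a : ℝ}
    (hf : (fun k => f k ^ 2) =O[atTop] fun k : ℕ => (k : ℝ) ^ a) :
    f =O[atTop] fun k : ℕ => (k : ℝ) ^ (a / 2) := by
  refine IsBigO.of_pow two_ne_zero (hf.congr_right fun k => ?_)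
  rw [Pi.pow_apply, ← Real.rpow_mul_natCast (by positivity), Nat.cast_ofNat,
    div_mul_cancel₀ _ two_ne_zero]

theorem isBigO_one_div_natCast_rpow {E : Type*} [NormedAddCommGroup E] {f : ℕ → E} {a b : ℝ}
    (hf : f =O[atTop] fun k : ℕ => (k : ℝ) ^ (-b)) (hab : a ≤ b) :
    f =O[atTop] fun k : ℕ => 1 / (k : ℝ) ^ a := by
  simpa only [one_div, Real.rpow_neg (Nat.cast_nonneg _)] using
    hf.trans (isBigO_natCast_rpow_rpow (neg_le_neg hab))

theorem isBigO_one_div_natCast_rpow_mul {f δ : ℕ → ℝ} {a : ℝ} (hδ : ∀ᶠ k in atTop, δ k ≠ 0)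
    (hf : (fun k => δ k * f k) =O[atTop] fun k : ℕ => (k : ℝ) ^ (-a)) :
    f =O[atTop] fun k : ℕ => 1 / ((k : ℝ) ^ a * δ k) := by
  refine ((isBigO_refl (fun k => (δ k)⁻¹) atTop).mul hf).congr' ?_
    (Eventually.of_forall fun k => ?_)
  · filter_upwards [hδ] with k hk
    rw [inv_mul_cancel_left₀ hk]
  · beta_reduce
    rw [Real.rpow_neg (Nat.cast_nonneg k), one_div, mul_inv, mul_comm]

theorem one_sub_mul_add_le_mul_add_one_rpow_neg {F e c m ω M t : ℝ} (ht : 0 < t) (hω : 0 ≤ ω)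
    (hM : 0 ≤ M) (hle : c * t ^ (-m) ≤ 1) (hωm : ω / t ≤ c / 2 * t ^ (-m))
    (hF : F ≤ M * t ^ (-ω)) (he : e ≤ M * (c / 2) * t ^ (-(m + ω))) :
    (1 - c * t ^ (-m)) * F + e ≤ M * (t + 1) ^ (-ω) := by
  have hcontract := mul_le_mul_of_nonneg_left hF (sub_nonneg.2 hle)
  have hdecay := mul_le_mul_of_nonneg_left hωm (by positivity : 0 ≤ M * t ^ (-ω))
  have hsucc := mul_le_mul_of_nonneg_left (one_sub_div_mul_rpow_neg_le hω ht) hM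
  rw [neg_add, Real.rpow_add ht] at he
  linarith

-- Since `m < 1`, the rate `c k ^ (-m)` dominates the relative decrease `ω / k` of `k ^ (-ω)`.
theorem isBigO_rpow_of_contraction {F e : ℕ → ℝ} {c m ω : ℝ} (hc : 0 < c) (hm0 : 0 < m)
    (hm : m < 1) (hω : 0 ≤ ω) (hF0 : ∀ᶠ k in atTop, 0 ≤ F k)
    (hF : ∀ᶠ k : ℕ in atTop, F (k + 1) ≤ (1 - c * (k : ℝ) ^ (-m)) * F k + e k)
    (he : e =O[atTop] fun k : ℕ => (k : ℝ) ^ (-(m + ω))) :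
    F =O[atTop] fun k : ℕ => (k : ℝ) ^ (-ω) := by
  obtain ⟨C, -, he⟩ := he.exists_pos
  have hsmall : ∀ᶠ k : ℕ in atTop, c * (k : ℝ) ^ (-m) ≤ 1 := by
    have hlim := (tendsto_natCast_rpow_neg hm0).const_mul c
    rw [mul_zero] at hlim
    exact hlim.eventually_le_const one_pos
  obtain ⟨N, hN⟩ := eventually_atTop.1 (hF.and (he.bound.and (hsmall.and
    ((eventually_div_le_mul_rpow_neg ω (half_pos hc) hm).and (eventually_gt_atTop 0)))))
  set M := max (max 0 (2 * C / c)) (F N / (N : ℝ) ^ (-ω))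
  have hM0 : 0 ≤ M := (le_max_left _ _).trans (le_max_left _ _)
  have hCM : C ≤ M * (c / 2) := by
    have hMC : 2 * C / c ≤ M := (le_max_right _ _).trans (le_max_left _ _)
    rw [div_le_iff₀ hc] at hMC
    linarith
  have hbound (k : ℕ) (hk : N ≤ k) : F k ≤ M * (k : ℝ) ^ (-ω) := by
    induction k, hk using Nat.le_induction with
    | base =>
      have hN0 : (0 : ℝ) < N := by exact_mod_cast (hN N le_rfl).2.2.2.2
      rw [← div_le_iff₀ (by positivity)]
      exact le_max_right _ _
    | succ k hk ih =>
      obtain ⟨hstep, herr, hle, hdecay, hk0⟩ := hN k hk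
      rw [Real.norm_of_nonneg (r := (k : ℝ) ^ (-(m + ω))) (by positivity)] at herr
      push_cast
      exact hstep.trans (one_sub_mul_add_le_mul_add_one_rpow_neg (by exact_mod_cast hk0) hω hM0
        hle hdecay ih ((le_abs_self _).trans (herr.trans (by gcongr))))
  refine IsBigO.of_bound M ?_
  filter_upwards [hF0, eventually_ge_atTop N] with k hk0 hk
  rw [Real.norm_of_nonneg hk0, Real.norm_of_nonneg (by positivity)]
  exact hbound k hk

theorem eventually_add_one_rpow_le {p : ℝ} (hp : 0 ≤ p) :
    ∀ᶠ k : ℕ in atTop, ((k : ℝ) + 1) ^ p ≤ (1 + 2 * (p / k)) * (k : ℝ) ^ p := by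
  filter_upwards [(tendsto_const_div_atTop_nhds_zero_nat p).eventually_le_const one_half_pos,
    eventually_gt_atTop 0] with k hsmall hk
  have hk0 : (0 : ℝ) < k := by exact_mod_cast hk
  have hdecay := one_sub_div_mul_rpow_neg_le hp hk0
  have hone : 1 ≤ (1 + 2 * (p / k)) * (1 - p / k) := by
    nlinarith [(by positivity : 0 ≤ p / k)]
  rw [Real.rpow_neg hk0.le, Real.rpow_neg (by positivity), ← div_eq_mul_inv,
    div_le_iff₀ (by positivity), ← div_eq_inv_mul, le_div_iff₀ (by positivity)] at hdecay
  calc ((k : ℝ) + 1) ^ p ≤ (1 + 2 * (p / k)) * (1 - p / k) * ((k : ℝ) + 1) ^ p :=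
        le_mul_of_one_le_left (by positivity) hone
    _ = (1 + 2 * (p / k)) * ((1 - p / k) * ((k : ℝ) + 1) ^ p) := by ring
    _ ≤ (1 + 2 * (p / k)) * (k : ℝ) ^ p := by gcongr

theorem GrowthCondition.exists_eventually_succ_le {p : ℝ} {δ : ℕ → ℝ} (h : GrowthCondition p δ)
    (hp : 0 ≤ p) (hδ : ∀ᶠ k in atTop, 0 ≤ δ k) :
    ∃ C, 0 ≤ C ∧ ∀ᶠ k : ℕ in atTop, δ (k + 1) ≤ (1 + C / k) * δ k := by
  obtain ⟨c, hc, h⟩ := h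
  refine ⟨4 * c * p, by positivity, ?_⟩
  filter_upwards [h, hδ, eventually_add_one_rpow_le hp, eventually_gt_atTop 0,
    (tendsto_const_div_atTop_nhds_zero_nat (2 * c * p)).eventually_le_const one_half_pos]
    with k hgrowth hδ hpow hk hsmall
  have : (0 : ℝ) < k := by exact_mod_cast hk
  set t := 2 * c * p / k with ht
  have ht0 : 0 ≤ t := by positivity
  have hdenom : (1 - t) * (k : ℝ) ^ p ≤ (1 + c) * (k : ℝ) ^ p - c * ((k : ℝ) + 1) ^ p := by
    have hscale := mul_le_mul_of_nonneg_left hpow hc.le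
    rw [ht]
    linear_combination hscale
  have hdenom0 : 0 < (1 - t) * (k : ℝ) ^ p := mul_pos (by linarith) (by positivity)
  refine hgrowth.trans (mul_le_mul_of_nonneg_right ?_ hδ)
  rw [div_le_iff₀ (hdenom0.trans_le hdenom), show 4 * c * p / k = 2 * t by rw [ht]; ring]
  have hone : 1 ≤ (1 + 2 * t) * (1 - t) := by nlinarith
  calc (k : ℝ) ^ p ≤ (1 + 2 * t) * (1 - t) * (k : ℝ) ^ p :=
        le_mul_of_one_le_left (by positivity) hone
    _ = (1 + 2 * t) * ((1 - t) * (k : ℝ) ^ p) := by ring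
    _ ≤ (1 + 2 * t) * ((1 + c) * (k : ℝ) ^ p - c * ((k : ℝ) + 1) ^ p) := by gcongr

end PowerSequences

section InertialScheme

variable {X : Type*} [NormedAddCommGroup X] [InnerProductSpace ℝ X] [CompleteSpace X]

/-- The velocity of the sequence `x` shifted by `b` times the gradient: the discrete counterpart of
`ẋ + b ∇g(x)` in an inertial dynamics with Hessian-driven damping. -/
noncomputable def gradientVelocity (g : X → ℝ) (b : ℝ) (x : ℕ → X) (k : ℕ) : X :=
  x k - x (k - 1) + b • gradient g (x k)

/-- For all large `k`, `x` follows an implicit inertial scheme with damping `γ k`, objective weight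
`D k` and regularization `A k`, all varying by a relative amount `O(1 / k)` per step; `z k` is the
minimizer of the regularized objective. The exponents `q` and `p` measure the decay of the damping
and of the regularization. -/
structure IsInertialScheme (g : X → ℝ) (b p q : ℝ) (γ D A : ℕ → ℝ) (z x : ℕ → X) : Prop where
  step_pos : 0 < b
  slowVariation : ∃ C, ∀ᶠ k : ℕ in atTop,
    SlowVariation (C / k) (γ k) (D k) (A k) (γ (k + 1)) (D (k + 1)) (A (k + 1))
  damping_isTheta : γ =Θ[atTop] fun k : ℕ => (k : ℝ) ^ (-q)
  weight_tendsto : Tendsto D atTop atTop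
  regularization_isTheta : A =Θ[atTop] fun k : ℕ => (k : ℝ) ^ (-p)
  isTikhonovPoint : ∀ᶠ k in atTop, IsTikhonovPoint g (A k / D k) (z k)
  recursion : ∀ᶠ k in atTop, gradientVelocity g b x k =
    gradientVelocity g b x (k + 1) + γ k • (x (k + 1) - x k)
      + (D k • gradient g (x (k + 1)) + A k • x (k + 1))

/-- The Lyapunov function along an inertial scheme. -/
noncomputable def schemeEnergy (g : X → ℝ) (b : ℝ) (γ D A : ℕ → ℝ) (z x : ℕ → X) (k : ℕ) : ℝ :=
  lyapunov (tikhonovGap g (D k) (A k) (z k) (x k)) (γ k) (x k - z k) (gradientVelocity g b x k)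

/-- The exponent `m` such that the energy is contracted by `1 - c k^(-m)` at the `k`-th step. -/
noncomputable def contractionExponent (p q : ℝ) : ℝ := max q (p - q)

/-- The exponent `ω` such that the energy is `O(k^(-ω))`: the largest one for which the error terms,
of order `k^(-1-p)` and `k^(m-2-2q)`, are `O(k^(-m-ω))` for the contraction exponent `m`. -/
noncomputable def energyExponent (p q : ℝ) : ℝ :=
  min (1 + p - contractionExponent p q) (2 + 2 * q - 2 * contractionExponent p q)

theorem contractionExponent_lt_one {p q : ℝ} (hq : q < 1) (hpq : p < q + 1) :
    contractionExponent p q < 1 :=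
  max_lt hq (by linarith)

theorem min_lt_energyExponent {p q : ℝ} (hq : q < 1) (hpq : p < q + 1) :
    min p (2 * q) < energyExponent p q := by
  have hm := contractionExponent_lt_one hq hpq
  exact lt_min ((min_le_left _ _).trans_lt (by linarith))
    ((min_le_right _ _).trans_lt (by linarith))

theorem energyExponent_of_le_two_mul {p q : ℝ} (hp : p ≤ 2 * q) (hpq : p ≤ q + 1) :
    energyExponent p q = 1 + p - q := by
  rw [energyExponent, contractionExponent, max_eq_left (by linarith), min_eq_left (by linarith)]

theorem energyExponent_of_two_mul_le {p q : ℝ} (hp : 2 * q ≤ p) (hp' : p ≤ (3 * q + 1) / 2) :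
    energyExponent p q = 1 + q := by
  rw [energyExponent, contractionExponent, max_eq_right (by linarith), min_eq_left (by linarith)]
  ring

theorem energyExponent_of_le {p q : ℝ} (hp : 2 * q ≤ p) (hp' : (3 * q + 1) / 2 ≤ p) :
    energyExponent p q = 2 + 4 * q - 2 * p := by
  rw [energyExponent, contractionExponent, max_eq_right (by linarith), min_eq_right (by linarith)]
  ring

namespace IsInertialScheme

variable {g : X → ℝ} {b p q : ℝ} {γ D A : ℕ → ℝ} {s : X} {z x : ℕ → X}

theorem eventually_pos (h : IsInertialScheme g b p q γ D A z x) :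
    ∀ᶠ k in atTop, 0 < γ k ∧ 0 < D k ∧ 0 < A k := by
  obtain ⟨C, hC⟩ := h.slowVariation
  filter_upwards [hC] with k hk
  exact ⟨hk.damping_pos.trans_le hk.damping_le, hk.weight_pos,
    hk.regularization_pos.trans_le hk.regularization_le⟩

theorem eventually_tikhonovGap_nonneg (h : IsInertialScheme g b p q γ D A z x) :
    ∀ᶠ k in atTop, ∀ y, 0 ≤ tikhonovGap g (D k) (A k) (z k) y := by
  filter_upwards [h.isTikhonovPoint, h.eventually_pos] with k hz hpos
  exact hz.tikhonovGap_nonneg hpos.2.1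

theorem damping_isBigO_one (h : IsInertialScheme g b p q γ D A z x) (hq : 0 ≤ q) :
    γ =O[atTop] fun _ => (1 : ℝ) := by
  simpa using h.damping_isTheta.1.trans (isBigO_natCast_rpow_rpow (neg_nonpos.2 hq))

theorem isLittleO_weight (h : IsInertialScheme g b p q γ D A z x) {f : ℕ → ℝ}
    (hf : f =O[atTop] fun _ => (1 : ℝ)) : f =o[atTop] D :=
  hf.trans_isLittleO
    (isLittleO_const_left.2 (Or.inr (tendsto_norm_atTop_atTop.comp h.weight_tendsto)))

theorem eventually_coupling_le (h : IsInertialScheme g b p q γ D A z x) (hq : 0 ≤ q)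
    (hqp : q ≤ p) : ∀ᶠ k in atTop, γ k * b ≤ D k ∧ 16 * b * A k ≤ γ k * D k := by
  have hγD : (fun k => b * γ k) =o[atTop] D :=
    (h.isLittleO_weight (h.damping_isBigO_one hq)).const_mul_left b
  have hAγ : A =O[atTop] γ :=
    h.regularization_isTheta.1.trans
      ((isBigO_natCast_rpow_rpow (neg_le_neg hqp)).trans h.damping_isTheta.2)
  have hAD : (fun k => 16 * b * (A k * 1)) =o[atTop] fun k => γ k * D k :=
    (hAγ.mul_isLittleO (h.isLittleO_weight (isBigO_refl _ _))).const_mul_left (16 * b)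
  filter_upwards [hγD.bound one_pos, hAD.bound one_pos, h.eventually_pos]
    with k hk hk' ⟨hγ, hD, hA⟩
  have hb := h.step_pos
  rw [Real.norm_of_nonneg (by positivity), Real.norm_of_nonneg (by positivity)] at hk hk'
  exact ⟨by linarith, by linarith⟩

theorem exists_eventually_isContractionRate (h : IsInertialScheme g b p q γ D A z x) {m : ℝ}
    (hq : 0 ≤ q) (hqp : q ≤ p) (hqm : q ≤ m) (hpm : p ≤ m + q) :
    ∃ c > 0, ∀ᶠ k : ℕ in atTop, IsContractionRate b (γ k) (D k) (A k) (c * (k : ℝ) ^ (-m)) := by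
  have hγ : (fun k : ℕ => (k : ℝ) ^ (-m)) =O[atTop] γ :=
    (isBigO_natCast_rpow_rpow (neg_le_neg hqm)).trans h.damping_isTheta.2
  have hA : (fun k : ℕ => (k : ℝ) ^ (-m) * γ k) =O[atTop] A :=
    ((isBigO_refl _ atTop).mul_atTop_rpow_natCast_of_isBigO_rpow (-m) (-q) (-p)
      h.damping_isTheta.1 (by linarith)).trans h.regularization_isTheta.2
  obtain ⟨c₁, hc₁, hγ⟩ := isBigO_iff''.1 hγ
  obtain ⟨c₂, hc₂, hA⟩ := isBigO_iff''.1 hA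
  obtain ⟨c, hc, hc1, hcc₁, hcc₂⟩ : ∃ c > 0, c ≤ 1 ∧ c ≤ c₁ / 8 ∧ c ≤ c₂ / 3 :=
    ⟨min 1 (min (c₁ / 8) (c₂ / 3)), by positivity, by simp⟩
  refine ⟨c, hc, ?_⟩
  filter_upwards [hγ, hA, h.eventually_coupling_le hq hqp, h.eventually_pos,
    h.weight_tendsto.eventually_ge_atTop (4 * b), eventually_ge_atTop 1]
    with k hγ hA ⟨hcoup, hcoup'⟩ ⟨hγ0, hD0, hA0⟩ hD hk
  have hb := h.step_pos
  have hk0 : (0 : ℝ) < k := by exact_mod_cast hk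
  rw [Real.norm_of_nonneg (by positivity), Real.norm_of_nonneg (by positivity)] at hγ hA
  set r := (k : ℝ) ^ (-m)
  have hr : 0 < r := by positivity
  have hcr1 : c * r ≤ 1 := mul_le_one₀ hc1 hr.le
    (Real.rpow_le_one_of_one_le_of_nonpos (by exact_mod_cast hk) (by linarith))
  exact
    { pos := by positivity
      le_one := hcr1
      eight_mul_le := le_trans (by linarith [mul_le_mul_of_nonneg_right hcc₁ hr.le]) hγ
      three_mul_mul_le :=
        le_trans (by linarith [mul_le_mul_of_nonneg_right hcc₂ (mul_pos hr hγ0).le]) hA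
      four_mul_mul_le := (mul_le_mul_of_nonneg_right (by linarith) hb.le).trans hD
      mul_le := hcoup
      sixteen_mul_mul_le := hcoup' }

theorem isBigO_energy_error (h : IsInertialScheme g b p q γ D A z x) {m ω : ℝ} (c C N : ℝ)
    (hω : m + ω ≤ 1 + p) (hωq : 2 * m + ω ≤ 2 + 2 * q) (hωp : m + ω ≤ 2 * p) :
    (fun k : ℕ => (2 * b * A k ^ 2 / D k + C / k * A k
      + 8 * γ k ^ 2 * (C / k) ^ 2 / (c * (k : ℝ) ^ (-m))) * N)
      =O[atTop] fun k : ℕ => (k : ℝ) ^ (-(m + ω)) := by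
  have hA := h.regularization_isTheta.1
  have hγ := h.damping_isTheta.1
  have hκ : (fun k : ℕ => C / k) =O[atTop] fun k : ℕ => (k : ℝ) ^ (-1 : ℝ) := by
    simpa only [Real.rpow_neg_one, div_eq_mul_inv] using
      isBigO_const_mul_self C (fun k : ℕ => (k : ℝ)⁻¹) atTop
  have hD : (fun k => (D k)⁻¹) =O[atTop] fun k : ℕ => (k : ℝ) ^ (0 : ℝ) := by
    simpa using h.weight_tendsto.inv_tendsto_atTop.isBigO_one ℝ
  have hr : (fun k : ℕ => (c * (k : ℝ) ^ (-m))⁻¹) =O[atTop] fun k : ℕ => (k : ℝ) ^ m := by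
    simpa only [mul_inv, Real.rpow_neg (Nat.cast_nonneg _), inv_inv] using
      isBigO_const_mul_self c⁻¹ (fun k : ℕ => (k : ℝ) ^ m) atTop
  have hcoupling := ((hA.mul_atTop_rpow_natCast_of_isBigO_rpow _ _ _ hA le_rfl
    ).mul_atTop_rpow_natCast_of_isBigO_rpow _ _ (-(m + ω)) hD (by linarith)).const_mul_left (2 * b)
  have hdrift := hκ.mul_atTop_rpow_natCast_of_isBigO_rpow _ _ (-(m + ω)) hA (by linarith)
  have hγκ := hγ.mul_atTop_rpow_natCast_of_isBigO_rpow _ _ _ hκ le_rfl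
  have htikhonov := ((hγκ.mul_atTop_rpow_natCast_of_isBigO_rpow _ _ _ hγκ le_rfl
    ).mul_atTop_rpow_natCast_of_isBigO_rpow _ _ (-(m + ω)) hr (by linarith)).const_mul_left 8
  refine (((hcoupling.add hdrift).add htikhonov).const_mul_left N).congr_left fun k => ?_
  simp only [Pi.mul_apply]
  ring

theorem isBigO_energy (h : IsInertialScheme g b p q γ D A z x) (hg : ConvexOn ℝ Set.univ g)
    (hd : Differentiable ℝ g) (hs : s ∈ argminSet g) {m ω : ℝ} (hq : 0 ≤ q) (hqp : q ≤ p)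
    (hm0 : 0 < m) (hm1 : m < 1) (hqm : q ≤ m) (hpm : p ≤ m + q) (hω0 : 0 ≤ ω)
    (hω : m + ω ≤ 1 + p) (hωq : 2 * m + ω ≤ 2 + 2 * q) (hωp : m + ω ≤ 2 * p) :
    schemeEnergy g b γ D A z x =O[atTop] fun k : ℕ => (k : ℝ) ^ (-ω) := by
  obtain ⟨C, hslow⟩ := h.slowVariation
  obtain ⟨c, hc, hrate⟩ := h.exists_eventually_isContractionRate hq hqp hqm hpm
  refine isBigO_rpow_of_contraction (c := c / 4) (by positivity) hm0 hm1 hω0 ?_ ?_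
    (h.isBigO_energy_error c C (‖s‖ ^ 2) hω hωq hωp)
  · exact h.eventually_tikhonovGap_nonneg.mono fun k hk => lyapunov_nonneg (hk _) _ _ _
  · filter_upwards [hslow, hrate, h.recursion, h.isTikhonovPoint,
      (tendsto_add_atTop_nat 1).eventually h.isTikhonovPoint,
      eventually_div_le_mul_rpow_neg (8 * C) hc hm1] with k hslow hrate hrec hz hz' hκ
    rw [mul_div_assoc] at hκ
    rw [div_mul_eq_mul_div]
    exact energy_succ_le hrate hslow hκ h.step_pos hg hd hs hz hz' hrec

section Rates

variable {ω : ℝ}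

theorem isBigO_norm_sub (h : IsInertialScheme g b p q γ D A z x) (hg : ConvexOn ℝ Set.univ g)
    (hd : Differentiable ℝ g)
    (hE : schemeEnergy g b γ D A z x =O[atTop] fun k : ℕ => (k : ℝ) ^ (-ω)) :
    (fun k => ‖x k - z k‖) =O[atTop] fun k : ℕ => (k : ℝ) ^ (-((ω - min p (2 * q)) / 2)) := by
  have of_weight {a : ℝ} {w : ℕ → ℝ} (hw : (fun k : ℕ => (k : ℝ) ^ (-a)) =O[atTop] w)
      (hle : ∀ᶠ k in atTop, 0 ≤ w k ∧ w k * ‖x k - z k‖ ^ 2 ≤ 8 * schemeEnergy g b γ D A z x k) :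
      (fun k => ‖x k - z k‖) =O[atTop] fun k : ℕ => (k : ℝ) ^ (-((ω - a) / 2)) := by
    have hprod : (fun k => w k * ‖x k - z k‖ ^ 2) =O[atTop] schemeEnergy g b γ D A z x := by
      refine IsBigO.of_bound 8 (hle.mono fun k ⟨hk, hk'⟩ => ?_)
      rw [Real.norm_of_nonneg (mul_nonneg hk (sq_nonneg _))]
      exact hk'.trans (by gcongr; exact Real.le_norm_self _)
    convert isBigO_natCast_rpow_half_of_sq (isBigO_natCast_rpow_of_mul hw (hprod.trans hE))
      using 3
    ring
  rcases min_cases p (2 * q) with ⟨hmin, -⟩ | ⟨hmin, -⟩ <;> rw [hmin]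
  · refine of_weight h.regularization_isTheta.2 ?_
    filter_upwards [h.eventually_pos, h.isTikhonovPoint] with k ⟨_, hDk, hAk⟩ hz
    have hgap := mul_norm_sub_sq_le_tikhonovGap hg hd hDk hz (x k)
    have hle := le_lyapunov (tikhonovGap g (D k) (A k) (z k) (x k)) (γ k) (x k - z k)
      (gradientVelocity g b x k)
    refine ⟨hAk.le, ?_⟩
    unfold schemeEnergy
    linarith [mul_nonneg hAk.le (sq_nonneg ‖x k - z k‖)]
  · have hγ : (fun k : ℕ => (k : ℝ) ^ (-(2 * q))) =O[atTop] fun k => γ k ^ 2 := by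
      refine (h.damping_isTheta.2.pow 2).congr_left fun k => ?_
      rw [← Real.rpow_mul_natCast (Nat.cast_nonneg k)]
      norm_num [mul_comm]
    refine of_weight hγ (h.eventually_tikhonovGap_nonneg.mono fun k hk => ⟨sq_nonneg _, ?_⟩)
    have hle := mul_norm_sq_le_lyapunov (hk (x k)) (γ k) (x k - z k) (gradientVelocity g b x k)
    unfold schemeEnergy
    linarith

theorem isBigO_weight_mul_sub (h : IsInertialScheme g b p q γ D A z x) (hs : s ∈ argminSet g)
    (hE : schemeEnergy g b γ D A z x =O[atTop] fun k : ℕ => (k : ℝ) ^ (-ω)) {τ : ℝ}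
    (hτω : τ ≤ ω) (hτp : τ ≤ p) :
    (fun k => D k * (g (x k) - g s)) =O[atTop] fun k : ℕ => (k : ℝ) ^ (-τ) := by
  have hE := hE.trans (isBigO_natCast_rpow_rpow (neg_le_neg hτω))
  have hA := (h.regularization_isTheta.1.trans
    (isBigO_natCast_rpow_rpow (neg_le_neg hτp))).const_mul_left (‖s‖ ^ 2 / 2)
  refine IsBigO.trans (IsBigO.of_bound 1 ?_) (hE.add hA)
  filter_upwards [h.eventually_pos, h.isTikhonovPoint] with k ⟨_, hDk, hAk⟩ hz
  have hmin : g s ≤ g (x k) := hs (Set.mem_univ _)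
  have hgap := mul_le_mul_of_nonneg_left (hz (Set.mem_univ s)) hDk.le
  have hcancel : D k * (A k / D k) = A k := mul_div_cancel₀ _ hDk.ne'
  have hle := le_lyapunov (tikhonovGap g (D k) (A k) (z k) (x k)) (γ k) (x k - z k)
    (gradientVelocity g b x k)
  rw [Real.norm_of_nonneg (mul_nonneg hDk.le (sub_nonneg.2 hmin)), one_mul]
  refine le_trans ?_ (Real.le_norm_self _)
  unfold schemeEnergy
  refine le_trans ?_ (add_le_add_left hle _)
  unfold tikhonovGap
  linear_combination hgap + (‖s‖ ^ 2 - ‖z k‖ ^ 2) / 2 * hcancel + A k / 2 * sq_nonneg ‖x k‖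

theorem isBigO_gradientVelocity (h : IsInertialScheme g b p q γ D A z x)
    (hE : schemeEnergy g b γ D A z x =O[atTop] fun k : ℕ => (k : ℝ) ^ (-ω)) :
    gradientVelocity g b x =O[atTop] fun k : ℕ => (k : ℝ) ^ (-(ω / 2)) := by
  rw [← isBigO_norm_left, ← neg_div]
  refine isBigO_natCast_rpow_half_of_sq (IsBigO.trans (IsBigO.of_bound 8 ?_) hE)
  filter_upwards [h.eventually_tikhonovGap_nonneg] with k hk
  rw [Real.norm_of_nonneg (sq_nonneg _)]
  exact (norm_sq_le_lyapunov (hk _) _ _ _).trans (by gcongr; exact Real.le_norm_self _)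

theorem weight_succ_isBigO (h : IsInertialScheme g b p q γ D A z x) (hq : 0 ≤ q) :
    (fun k => D (k + 1)) =O[atTop] fun k => D k - b * γ k := by
  obtain ⟨C, hC⟩ := h.slowVariation
  have hsucc : (fun k => D (k + 1)) =O[atTop] D := by
    refine IsBigO.of_bound 2 ?_
    filter_upwards [hC, (tendsto_const_div_atTop_nhds_zero_nat C).eventually_le_const one_pos]
      with k hk hκ
    rw [Real.norm_of_nonneg (hk.weight_pos.le.trans hk.weight_le),
      Real.norm_of_nonneg hk.weight_pos.le]
    exact hk.le_weight.trans (mul_le_mul_of_nonneg_right (by linarith) hk.weight_pos.le)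
  have hγ := h.isLittleO_weight ((h.damping_isBigO_one hq).const_mul_left b)
  exact hsucc.trans hγ.right_isBigO_sub

theorem isBigO_weight_smul_gradient (h : IsInertialScheme g b p q γ D A z x) (hq : 0 ≤ q)
    (hω : ω ≤ 2 * p) (hx : x =O[atTop] fun _ => (1 : ℝ))
    (hE : schemeEnergy g b γ D A z x =O[atTop] fun k : ℕ => (k : ℝ) ^ (-ω)) :
    (fun k => D k • gradient g (x k)) =O[atTop] fun k : ℕ => (k : ℝ) ^ (-(ω / 2)) := by
  have hv := h.isBigO_gradientVelocity hE
  have hv' := isBigO_natCast_rpow_comp_succ_iff.2 hv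
  have hγv : (fun k => γ k • gradientVelocity g b x (k + 1))
      =O[atTop] fun k : ℕ => (k : ℝ) ^ (-(ω / 2)) := by
    simpa using (h.damping_isBigO_one hq).smul hv'
  have hA : A =O[atTop] fun k : ℕ => (k : ℝ) ^ (-(ω / 2)) :=
    h.regularization_isTheta.1.trans (isBigO_natCast_rpow_rpow (by linarith))
  have hAx : (fun k => A k • x (k + 1)) =O[atTop] fun k : ℕ => (k : ℝ) ^ (-(ω / 2)) := by
    simpa using hA.smul (hx.comp_tendsto (tendsto_add_atTop_nat 1))
  rw [← isBigO_natCast_rpow_comp_succ_iff]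
  refine ((h.weight_succ_isBigO hq).smul (isBigO_refl (fun k => gradient g (x (k + 1))) _)).trans
    ((((hv.sub hv').sub hγv).sub hAx).congr' ?_ EventuallyEq.rfl)
  filter_upwards [h.recursion] with k hk
  rw [hk]
  simp only [gradientVelocity, add_tsub_cancel_right]
  module

theorem isBigO_velocity (h : IsInertialScheme g b p q γ D A z x)
    (hE : schemeEnergy g b γ D A z x =O[atTop] fun k : ℕ => (k : ℝ) ^ (-ω))
    (hD : (fun k => D k • gradient g (x k)) =O[atTop] fun k : ℕ => (k : ℝ) ^ (-(ω / 2))) :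
    (fun k => x k - x (k - 1)) =O[atTop] fun k : ℕ => (k : ℝ) ^ (-(ω / 2)) := by
  have hone : (fun _ => b) =O[atTop] D :=
    (h.isLittleO_weight (isBigO_const_const b one_ne_zero _)).isBigO
  refine ((h.isBigO_gradientVelocity hE).sub
    ((hone.smul (isBigO_refl (fun k => gradient g (x k)) _)).trans hD)).congr_left fun k => ?_
  simp only [gradientVelocity, add_sub_cancel_right]

end Rates

theorem isBigO_energy_energyExponent (h : IsInertialScheme g b p q γ D A z x)
    (hg : ConvexOn ℝ Set.univ g) (hd : Differentiable ℝ g) (hs : s ∈ argminSet g) (hq : q < 1)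
    (hp : 1 ≤ p) (hpq : p < q + 1) :
    schemeEnergy g b γ D A z x =O[atTop] fun k : ℕ => (k : ℝ) ^ (-energyExponent p q) := by
  have hqm : q ≤ contractionExponent p q := le_max_left _ _
  have hpm : p - q ≤ contractionExponent p q := le_max_right _ _
  have hω : energyExponent p q ≤ 1 + p - contractionExponent p q := min_le_left _ _
  have hωq : energyExponent p q ≤ 2 + 2 * q - 2 * contractionExponent p q := min_le_right _ _
  have hω0 : 0 ≤ min p (2 * q) := le_min (by linarith) (by linarith)
  exact h.isBigO_energy hg hd hs (by linarith) (by linarith) (by linarith)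
    (contractionExponent_lt_one hq hpq) hqm (by linarith)
    (hω0.trans (min_lt_energyExponent hq hpq).le) (by linarith) (by linarith) (by linarith)

theorem tendsto (h : IsInertialScheme g b p q γ D A z x) (hg : ConvexOn ℝ Set.univ g)
    (hd : Differentiable ℝ g) (hs : s ∈ argminSet g) (hz : Tendsto z atTop (𝓝 s)) (hq : q < 1)
    (hp : 1 ≤ p) (hpq : p < q + 1) : Tendsto x atTop (𝓝 s) := by
  have hdist := h.isBigO_norm_sub hg hd (h.isBigO_energy_energyExponent hg hd hs hq hp hpq)
  have hzero := hdist.trans_tendsto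
    (tendsto_natCast_rpow_neg (half_pos (sub_pos.2 (min_lt_energyExponent hq hpq))))
  simpa using (tendsto_zero_iff_norm_tendsto_zero.2 hzero).add hz

theorem rates (h : IsInertialScheme g b p q γ D A z x) (hg : ConvexOn ℝ Set.univ g)
    (hd : Differentiable ℝ g) (hs : s ∈ argminSet g) (hz : Tendsto z atTop (𝓝 s)) (hq : q < 1)
    (hp : 1 ≤ p) (hpq : p < q + 1) {δ : ℕ → ℝ} (hδ : δ =O[atTop] D)
    (hδ0 : ∀ᶠ k in atTop, δ k ≠ 0) :
    (∀ τ ≤ energyExponent p q, τ ≤ p →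
      (fun k => g (x k) - g s) =O[atTop] fun k : ℕ => 1 / ((k : ℝ) ^ τ * δ k)) ∧
    (∀ σ ≤ (energyExponent p q - min p (2 * q)) / 2,
      (fun k => ‖x k - z k‖) =O[atTop] fun k : ℕ => 1 / (k : ℝ) ^ σ) ∧
    ∀ ρ ≤ energyExponent p q / 2,
      (fun k => ‖gradient g (x k)‖) =O[atTop] (fun k : ℕ => 1 / ((k : ℝ) ^ ρ * δ k)) ∧
      (fun k => ‖x k - x (k - 1)‖) =O[atTop] fun k : ℕ => 1 / (k : ℝ) ^ ρ := by
  have hE := h.isBigO_energy_energyExponent hg hd hs hq hp hpq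
  have hx := (h.tendsto hg hd hs hz hq hp hpq).isBigO_one ℝ
  have hqm : q ≤ contractionExponent p q := le_max_left _ _
  have hω : energyExponent p q ≤ 2 * p := (min_le_left _ _).trans (by linarith)
  have hgrad := h.isBigO_weight_smul_gradient (by linarith) hω hx hE
  have hnorm : (fun k => D k * ‖gradient g (x k)‖)
      =O[atTop] fun k : ℕ => (k : ℝ) ^ (-(energyExponent p q / 2)) := by
    rw [← isBigO_norm_left]
    simpa only [norm_mul, norm_norm, norm_smul] using hgrad.norm_left
  refine ⟨fun τ hτ hτp => ?_,
    fun σ hσ => isBigO_one_div_natCast_rpow (h.isBigO_norm_sub hg hd hE) hσ, fun ρ hρ => ⟨?_,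
      (isBigO_one_div_natCast_rpow (h.isBigO_velocity hE hgrad) hρ).norm_left⟩⟩
  · exact isBigO_one_div_natCast_rpow_mul hδ0
      ((hδ.mul (isBigO_refl _ _)).trans (h.isBigO_weight_mul_sub hs hE hτ hτp))
  · exact isBigO_one_div_natCast_rpow_mul hδ0 (((hδ.mul (isBigO_refl _ _)).trans hnorm).trans
      (isBigO_natCast_rpow_rpow (neg_le_neg hρ)))

end IsInertialScheme

end InertialScheme

section InertialProximalGradient

section TikhonovParam

variable {a h r : ℝ} {k : ℕ}

theorem tikhonovParam_pos (ha : 0 < a) (hh : 0 < h) (hk : 1 ≤ k) : 0 < tikhonovParam a h r k := by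
  have : (0 : ℝ) < k := by exact_mod_cast hk
  unfold tikhonovParam
  positivity

theorem tikhonovParam_eq (hh : 0 ≤ h) :
    tikhonovParam a h r k = a * h ^ (-r) * (k : ℝ) ^ (-r) := by
  rw [tikhonovParam, Real.mul_rpow (Nat.cast_nonneg k) hh]
  ring

theorem tikhonovParam_succ_le (ha : 0 ≤ a) (hh : 0 < h) (hr : 0 ≤ r) (hk : 1 ≤ k) :
    tikhonovParam a h r (k + 1) ≤ tikhonovParam a h r k := by
  have : (0 : ℝ) < k := by exact_mod_cast hk
  unfold tikhonovParam
  refine mul_le_mul_of_nonneg_left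
    (Real.rpow_le_rpow_of_nonpos (by positivity) ?_ (neg_nonpos.2 hr)) ha
  gcongr
  exact Nat.le_succ k

theorem mul_tikhonovParam_le_succ {κ : ℝ} (ha : 0 ≤ a) (hh : 0 ≤ h) (hr : 0 ≤ r) (hk : 1 ≤ k)
    (hκ : r / k ≤ κ) : (1 - κ) * tikhonovParam a h r k ≤ tikhonovParam a h r (k + 1) := by
  have hk0 : (0 : ℝ) < k := by exact_mod_cast hk
  rw [tikhonovParam_eq hh, tikhonovParam_eq hh, mul_left_comm, Nat.cast_succ]
  gcongr
  exact (by gcongr : (1 - κ) * _ ≤ _).trans (one_sub_div_mul_rpow_neg_le hr hk0)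

theorem tikhonovParam_isTheta (ha : a ≠ 0) (hh : 0 < h) :
    tikhonovParam a h r =Θ[atTop] fun k : ℕ => (k : ℝ) ^ (-r) := by
  have hc : a * h ^ (-r) ≠ 0 := mul_ne_zero ha (Real.rpow_pos_of_pos hh _).ne'
  simpa only [← tikhonovParam_eq hh.le] using
    (isTheta_const_mul_left hc).2 (isTheta_refl (fun k : ℕ => (k : ℝ) ^ (-r)) atTop)

end TikhonovParam

theorem GrowthCondition.exists_eventually_slowVariation {a a' c h p q : ℝ} {δ : ℕ → ℝ}
    (hδ : GrowthCondition p δ) (ha : 0 < a) (ha' : 0 < a') (hh : 0 < h) (hq : 0 ≤ q) (hp : 0 ≤ p)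
    (hδ_pos : ∀ k : ℕ, 1 ≤ k → 0 < δ k) (hδ_mono : ∀ k : ℕ, 1 ≤ k → δ k ≤ δ (k + 1))
    (hc : 0 < c) :
    ∃ C, ∀ᶠ k : ℕ in atTop, SlowVariation (C / k)
      (tikhonovParam a h q k) (c * δ k) (tikhonovParam a' h p k)
      (tikhonovParam a h q (k + 1)) (c * δ (k + 1)) (tikhonovParam a' h p (k + 1)) := by
  obtain ⟨C, hC, hgrowth⟩ := hδ.exists_eventually_succ_le hp
    (eventually_atTop.2 ⟨1, fun k hk => (hδ_pos k hk).le⟩)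
  refine ⟨q + p + C, ?_⟩
  filter_upwards [hgrowth, eventually_ge_atTop 1] with k hgrowth hk
  have hδk := hδ_pos k hk
  have hle {r : ℝ} (hr : r ≤ q + p + C) : r / k ≤ (q + p + C) / k := by gcongr
  have hκ : δ (k + 1) ≤ (1 + (q + p + C) / k) * δ k :=
    hgrowth.trans (by gcongr; exact le_add_of_nonneg_left (add_nonneg hq hp))
  exact
    { damping_pos := tikhonovParam_pos ha hh k.succ_pos
      damping_le := tikhonovParam_succ_le ha.le hh hq hk
      le_damping := mul_tikhonovParam_le_succ ha.le hh.le hq hk (hle (by linarith))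
      weight_pos := mul_pos hc hδk
      weight_le := mul_le_mul_of_nonneg_left (hδ_mono k hk) hc.le
      le_weight := mul_left_comm c _ (δ k) ▸ mul_le_mul_of_nonneg_left hκ hc.le
      regularization_pos := tikhonovParam_pos ha' hh k.succ_pos
      regularization_le := tikhonovParam_succ_le ha'.le hh hp hk
      le_regularization := mul_tikhonovParam_le_succ ha'.le hh.le hp hk (hle (by linarith)) }

theorem inertialParam_pos {α a h q p : ℝ} (hα : 0 < α) (ha : 0 < a) (hh : 0 < h) {k : ℕ}
    (hk : 1 ≤ k) : 0 < inertialParam α a h q p k := by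
  have : (0 : ℝ) < k := by exact_mod_cast hk
  unfold inertialParam
  positivity

theorem add_tikhonovParam_mul_inertialParam {α a h q p : ℝ} (hα : 0 < α) (ha : 0 < a) (hh : 0 < h)
    {k : ℕ} (hk : 1 ≤ k) :
    (1 + tikhonovParam (α * h) h q k + tikhonovParam (h ^ 2 * a) h p k)
      * inertialParam α a h q p k = 1 := by
  have : (0 : ℝ) < k := by exact_mod_cast hk
  have hT : 0 < (k : ℝ) * h := by positivity
  rw [tikhonovParam, tikhonovParam, inertialParam, Real.rpow_neg hT.le, Real.rpow_neg hT.le,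
    Real.rpow_add hT]
  field_simp

variable {X : Type*} [NormedAddCommGroup X] [InnerProductSpace ℝ X] [CompleteSpace X]
  {g : X → ℝ} {α a β h q p : ℝ} {δ : ℕ → ℝ} {z x : ℕ → X}

theorem IsIPGASequence.gradientVelocity_eq (hx : IsIPGASequence g α a β h q p δ x)
    (hd : Differentiable ℝ g) (hα : 0 < α) (ha : 0 < a) (hβ : 0 ≤ β) (hh : 0 < h) {k : ℕ}
    (hk : 1 ≤ k) (hδ : 0 < δ k) :
    gradientVelocity g (β * h) x k = gradientVelocity g (β * h) x (k + 1)
      + tikhonovParam (α * h) h q k • (x (k + 1) - x k)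
      + ((h ^ 2 * δ k) • gradient g (x (k + 1)) + tikhonovParam (h ^ 2 * a) h p k • x (k + 1)) := by
  have hinv := add_tikhonovParam_mul_inertialParam (q := q) (p := p) hα ha hh hk
  have hpos := inertialParam_pos (q := q) (p := p) hα ha hh hk
  have hρ : stepSize α a β h q p δ k ≠ 0 := by
    unfold stepSize
    positivity
  have hprox := (hx k hk).add_smul_gradient_eq hρ (hd _)
  have hA : h ^ 2 * inertialParam α a h q p k * tikhonovParam a h p k =
      inertialParam α a h q p k * tikhonovParam (h ^ 2 * a) h p k := by
    unfold tikhonovParam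
    ring
  rw [hA, stepSize] at hprox
  set d := inertialParam α a h q p k
  set γ := tikhonovParam (α * h) h q k
  set A := tikhonovParam (h ^ 2 * a) h p k
  simp only [gradientVelocity, add_tsub_cancel_right]
  -- Multiply the optimality condition of the proximal step by `1 + γ + A = d⁻¹`.
  linear_combination (norm := module) (-(1 + γ + A)) • hprox
    + hinv • ((β * h + h ^ 2 * δ k) • gradient g (x (k + 1))
      - (x k - x (k - 1) + (β * h) • gradient g (x k)) + A • x k)

theorem IsIPGASequence.isInertialScheme (hx : IsIPGASequence g α a β h q p δ x)
    (hd : Differentiable ℝ g) (hα : 0 < α) (ha : 0 < a) (hβ : 0 < β) (hh : 0 < h)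
    (hq : 0 ≤ q) (hp : 0 ≤ p) (hδ_pos : ∀ k : ℕ, 1 ≤ k → 0 < δ k)
    (hδ_mono : ∀ k : ℕ, 1 ≤ k → δ k ≤ δ (k + 1)) (hδ_lim : Tendsto δ atTop atTop)
    (hδ_growth : GrowthCondition p δ)
    (hz : ∀ k : ℕ, 1 ≤ k → IsTikhonovPoint g (tikhonovParam a h p k / δ k) (z k)) :
    IsInertialScheme g (β * h) p q (tikhonovParam (α * h) h q) (fun k => h ^ 2 * δ k)
      (tikhonovParam (h ^ 2 * a) h p) z x where
  step_pos := by positivity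
  slowVariation := hδ_growth.exists_eventually_slowVariation (by positivity) (by positivity) hh hq
    hp hδ_pos hδ_mono (by positivity)
  damping_isTheta := tikhonovParam_isTheta (by positivity) hh
  weight_tendsto := hδ_lim.const_mul_atTop (by positivity)
  regularization_isTheta := tikhonovParam_isTheta (by positivity) hh
  isTikhonovPoint := by
    filter_upwards [eventually_ge_atTop 1] with k hk
    have hratio : tikhonovParam (h ^ 2 * a) h p k / (h ^ 2 * δ k) =
        tikhonovParam a h p k / δ k := by
      rw [tikhonovParam, mul_assoc, mul_div_mul_left _ _ (by positivity), tikhonovParam]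
    exact hratio ▸ hz k hk
  recursion := by
    filter_upwards [eventually_ge_atTop 1] with k hk
    exact hx.gradientVelocity_eq hd hα ha hβ.le hh hk (hδ_pos k hk)

theorem tendsto_of_isTikhonovPoint_tikhonovParam {s : X} (hg : ConvexOn ℝ Set.univ g)
    (hd : Differentiable ℝ g) (hs : IsMinNormSolution g s) (ha : 0 < a) (hh : 0 < h) (hp : 0 < p)
    (hδ_pos : ∀ k : ℕ, 1 ≤ k → 0 < δ k) (hδ_mono : ∀ k : ℕ, 1 ≤ k → δ k ≤ δ (k + 1))
    (hδ_lim : Tendsto δ atTop atTop)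
    (hz : ∀ k : ℕ, 1 ≤ k → IsTikhonovPoint g (tikhonovParam a h p k / δ k) (z k)) :
    Tendsto z atTop (𝓝 s) := by
  have hε : Tendsto (fun k => tikhonovParam a h p k / δ k) atTop (𝓝 0) :=
    ((tikhonovParam_isTheta ha.ne' hh).1.trans_tendsto (tendsto_natCast_rpow_neg hp)).div_atTop
      hδ_lim
  rw [← tendsto_add_atTop_iff_nat 1] at hε ⊢
  refine tendsto_of_isTikhonovPoint hg hd hs
    (fun k => div_pos (tikhonovParam_pos ha hh k.succ_pos) (hδ_pos _ k.succ_pos))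
    (antitone_nat_of_succ_le fun k => ?_) hε fun k => hz _ k.succ_pos
  exact div_le_div₀ (tikhonovParam_pos ha hh k.succ_pos).le
    (tikhonovParam_succ_le ha.le hh hp.le k.succ_pos) (hδ_pos _ k.succ_pos)
    (hδ_mono _ k.succ_pos)

end InertialProximalGradient

theorem theorem4p2_general {X : Type*} [NormedAddCommGroup X] [InnerProductSpace ℝ X]
    [CompleteSpace X]
    (g : X → ℝ) (hg_conv : ConvexOn ℝ Set.univ g) (hg_diff : Differentiable ℝ g)
    (hg_sol : (argminSet g).Nonempty)
    (α a β h q p : ℝ) (hα : 0 < α) (ha : 0 < a) (hβ : 0 < β) (hh : 0 < h)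
    (hq1 : q < 1) (hp1 : 1 ≤ p) (hpq : p < q + 1)
    (δ : ℕ → ℝ) (hδ_pos : ∀ k : ℕ, 1 ≤ k → 0 < δ k)
    (hδ_mono : ∀ k : ℕ, 1 ≤ k → δ k ≤ δ (k + 1)) (hδ_lim : Tendsto δ atTop atTop)
    (hδ_growth : GrowthCondition p δ) :
    (∃! z : X, IsMinNormSolution g z) ∧
    (∀ k : ℕ, 1 ≤ k → ∃! z : X, IsTikhonovPoint g (tikhonovParam a h p k / δ k) z) ∧
    ∀ (xstar : X) (xbar : ℕ → X) (x : ℕ → X),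
      IsMinNormSolution g xstar →
      (∀ k : ℕ, 1 ≤ k → IsTikhonovPoint g (tikhonovParam a h p k / δ k) (xbar k)) →
      IsIPGASequence g α a β h q p δ x →
      Tendsto x atTop (𝓝 xstar) ∧
      (p < 2 * q →
        (fun k : ℕ => g (x k) - g xstar) =O[atTop] (fun k : ℕ => 1 / ((k : ℝ) ^ p * δ k)) ∧
        (fun k : ℕ => ‖x k - xbar k‖) =O[atTop] (fun k : ℕ => 1 / (k : ℝ) ^ ((1 - q) / 2)) ∧
        (fun k : ℕ => ‖gradient g (x k)‖) =O[atTop]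
          (fun k : ℕ => 1 / ((k : ℝ) ^ ((p - q + 1) / 2) * δ k)) ∧
        (fun k : ℕ => ‖x k - x (k - 1)‖) =O[atTop]
          (fun k : ℕ => 1 / (k : ℝ) ^ ((p - q + 1) / 2))) ∧
      (2 * q ≤ p → p < (3 * q + 1) / 2 →
        (fun k : ℕ => g (x k) - g xstar) =O[atTop] (fun k : ℕ => 1 / ((k : ℝ) ^ p * δ k)) ∧
        (fun k : ℕ => ‖x k - xbar k‖) =O[atTop] (fun k : ℕ => 1 / (k : ℝ) ^ ((1 - q) / 2)) ∧
        (fun k : ℕ => ‖gradient g (x k)‖) =O[atTop]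
          (fun k : ℕ => 1 / ((k : ℝ) ^ ((q + 1) / 2) * δ k)) ∧
        (fun k : ℕ => ‖x k - x (k - 1)‖) =O[atTop]
          (fun k : ℕ => 1 / (k : ℝ) ^ ((q + 1) / 2))) ∧
      ((3 * q + 1) / 2 ≤ p →
        (fun k : ℕ => ‖x k - xbar k‖) =O[atTop] (fun k : ℕ => 1 / (k : ℝ) ^ (q - p + 1)) ∧
        (fun k : ℕ => ‖gradient g (x k)‖) =O[atTop]
          (fun k : ℕ => 1 / ((k : ℝ) ^ (2 * q - p + 1) * δ k)) ∧
        (fun k : ℕ => ‖x k - x (k - 1)‖) =O[atTop]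
          (fun k : ℕ => 1 / (k : ℝ) ^ (2 * q - p + 1)) ∧
        (p < (4 * q + 2) / 3 →
          (fun k : ℕ => g (x k) - g xstar) =O[atTop]
            (fun k : ℕ => 1 / ((k : ℝ) ^ p * δ k))) ∧
        ((4 * q + 2) / 3 ≤ p →
          (fun k : ℕ => g (x k) - g xstar) =O[atTop]
            (fun k : ℕ => 1 / ((k : ℝ) ^ (4 * q - 2 * p + 2) * δ k)))) := by
  have hcont := hg_diff.continuous.lowerSemicontinuous
  refine ⟨existsUnique_isMinNormSolution hg_conv hcont hg_sol, fun k hk =>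
    existsUnique_isTikhonovPoint hg_conv hcont
      (bddBelow_range_of_mem_argminSet hg_sol.some_mem)
      (div_pos (tikhonovParam_pos ha hh hk) (hδ_pos k hk)), fun xstar xbar x hs hz hx => ?_⟩
  have hscheme := hx.isInertialScheme hg_diff hα ha hβ hh (by linarith) (by linarith) hδ_pos
    hδ_mono hδ_lim hδ_growth hz
  have hlim := tendsto_of_isTikhonovPoint_tikhonovParam hg_conv hg_diff hs ha hh (by linarith)
    hδ_pos hδ_mono hδ_lim hz
  obtain ⟨hval, hdist, hgrad⟩ := hscheme.rates hg_conv hg_diff hs.1 hlim hq1 hp1 hpq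
    (isBigO_self_const_mul (pow_ne_zero 2 hh.ne') δ atTop) (hδ_lim.eventually_ne_atTop 0)
  refine ⟨hscheme.tendsto hg_conv hg_diff hs.1 hlim hq1 hp1 hpq, fun hp => ?_, fun hp hp' => ?_,
    fun hp => ?_⟩
  · rw [energyExponent_of_le_two_mul hp.le hpq.le] at hval hdist hgrad
    rw [min_eq_left hp.le] at hdist
    exact ⟨hval p (by linarith) le_rfl, hdist _ (by linarith), hgrad _ (by linarith)⟩
  · rw [energyExponent_of_two_mul_le hp hp'.le] at hval hdist hgrad
    rw [min_eq_right hp] at hdist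
    exact ⟨hval p (by linarith) le_rfl, hdist _ (by linarith), hgrad _ (by linarith)⟩
  · have hqp : 2 * q ≤ p := by linarith
    rw [energyExponent_of_le hqp hp] at hval hdist hgrad
    rw [min_eq_right hqp] at hdist
    have hgrad := hgrad (2 * q - p + 1) (by linarith)
    exact ⟨hdist _ (by linarith), hgrad.1, hgrad.2, fun _ => hval p (by linarith) le_rfl,
      fun _ => hval _ (by linarith) (by linarith)⟩

theorem theorem4p2 {X : Type*} [NormedAddCommGroup X] [InnerProductSpace ℝ X] [CompleteSpace X]
    (g : X → ℝ) (hg_conv : ConvexOn ℝ Set.univ g) (hg_diff : Differentiable ℝ g)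
    (hg_sol : (argminSet g).Nonempty)
    (α a β h q p : ℝ) (hα : 0 < α) (ha : 0 < a) (hβ : 0 < β) (hh : 0 < h)
    (hq0 : 0 < q) (hq1 : q < 1) (hp1 : 1 < p) (hpq : p < q + 1)
    (δ : ℕ → ℝ) (hδ_pos : ∀ k : ℕ, 1 ≤ k → 0 < δ k)
    (hδ_mono : ∀ k : ℕ, 1 ≤ k → δ k ≤ δ (k + 1)) (hδ_lim : Tendsto δ atTop atTop)
    (hδ_growth : GrowthCondition p δ)
    (hδ_lower : ∃ c₀ : ℝ, 0 < c₀ ∧ ∀ k : ℕ, 1 ≤ k → c₀ * (k : ℝ) ^ (p - q) ≤ δ k ^ 2) :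
    (∃! z : X, IsMinNormSolution g z) ∧
    (∀ k : ℕ, 1 ≤ k → ∃! z : X, IsTikhonovPoint g (tikhonovParam a h p k / δ k) z) ∧
    ∀ (xstar : X) (xbar : ℕ → X) (x : ℕ → X),
      IsMinNormSolution g xstar →
      (∀ k : ℕ, 1 ≤ k → IsTikhonovPoint g (tikhonovParam a h p k / δ k) (xbar k)) →
      IsIPGASequence g α a β h q p δ x →
      Tendsto x atTop (𝓝 xstar) ∧
      (p < 2 * q →
        (fun k : ℕ => g (x k) - g xstar) =O[atTop] (fun k : ℕ => 1 / ((k : ℝ) ^ p * δ k)) ∧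
        (fun k : ℕ => ‖x k - xbar k‖) =O[atTop] (fun k : ℕ => 1 / (k : ℝ) ^ ((1 - q) / 2)) ∧
        (fun k : ℕ => ‖gradient g (x k)‖) =O[atTop]
          (fun k : ℕ => 1 / ((k : ℝ) ^ ((p - q + 1) / 2) * δ k)) ∧
        (fun k : ℕ => ‖x k - x (k - 1)‖) =O[atTop]
          (fun k : ℕ => 1 / (k : ℝ) ^ ((p - q + 1) / 2))) ∧
      (2 * q ≤ p → p < (3 * q + 1) / 2 →
        (fun k : ℕ => g (x k) - g xstar) =O[atTop] (fun k : ℕ => 1 / ((k : ℝ) ^ p * δ k)) ∧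
        (fun k : ℕ => ‖x k - xbar k‖) =O[atTop] (fun k : ℕ => 1 / (k : ℝ) ^ ((1 - q) / 2)) ∧
        (fun k : ℕ => ‖gradient g (x k)‖) =O[atTop]
          (fun k : ℕ => 1 / ((k : ℝ) ^ ((q + 1) / 2) * δ k)) ∧
        (fun k : ℕ => ‖x k - x (k - 1)‖) =O[atTop]
          (fun k : ℕ => 1 / (k : ℝ) ^ ((q + 1) / 2))) ∧
      ((3 * q + 1) / 2 ≤ p →
        (fun k : ℕ => ‖x k - xbar k‖) =O[atTop] (fun k : ℕ => 1 / (k : ℝ) ^ (q - p + 1)) ∧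
        (fun k : ℕ => ‖gradient g (x k)‖) =O[atTop]
          (fun k : ℕ => 1 / ((k : ℝ) ^ (2 * q - p + 1) * δ k)) ∧
        (fun k : ℕ => ‖x k - x (k - 1)‖) =O[atTop]
          (fun k : ℕ => 1 / (k : ℝ) ^ (2 * q - p + 1)) ∧
        (p < (4 * q + 2) / 3 →
          (fun k : ℕ => g (x k) - g xstar) =O[atTop]
            (fun k : ℕ => 1 / ((k : ℝ) ^ p * δ k))) ∧
        ((4 * q + 2) / 3 ≤ p →
          (fun k : ℕ => g (x k) - g xstar) =O[atTop]
            (fun k : ℕ => 1 / ((k : ℝ) ^ (4 * q - 2 * p + 2) * δ k)))) :=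
  theorem4p2_general g hg_conv hg_diff hg_sol α a β h q p hα ha hβ hh hq1 hp1.le hpq δ hδ_pos
    hδ_mono hδ_lim hδ_growth
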